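/- Let $-\infty<\omega_*<\omega^*<+\infty$, $T>0$ and $C\in\mathbb{R}$. Let $(e_1,e_2,e_3)$ be the canonical basis of $\mathbb{R}^3$, $\wedge$ the cross product, $\langle\cdot,\cdot\rangle$ and $\|\cdot\|$ the Euclidean scalar product and norm (and $\|\cdot\|$ also the associated operator norm on $3\times 3$ matrices), and $\|f\|_{H^1}^2=\int_{\omega_*}^{\omega^*}(\|f(\omega)\|^2+\|f'(\omega)\|^2)\,d\omega$. Elements of $H^1(\omega_*,\omega^*)$ are identified with their continuous representatives on $[\omega_*,\omega^*]$. Put $$\varepsilon(t)=(-1)^{\lfloor t/T\rfloor},\qquad \sigma(t)=\int_0^t\varepsilon(s)\,ds,\qquad S=\begin{pmatrix}0&1&0\\-1&0&0\\0&0&0\end{pmatrix}.$$ Let $M_f\in H^1((\omega_*,\omega^*),\mathbb{S}^2)$ satisfy $\langle M_f(\omega),e_3\rangle\neq 0$ for all $\omega\in[\omega_*,\omega^*]$. Then there is $\delta_1>0$ such that the following holds for every $R\in H^1((\omega_*,\omega^*),SO_3(\mathbb{R}))$ with $R(\omega)M_f(\omega)=-e_3$ for all $\omega\in[\omega_*,\omega^*]$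 and $\|R\|_{H^1}\le C\|M_f\|_{H^1}$. Let $F(t,\omega)=R(\omega)\exp(\sigma(t)\,\omega\,S)$ and, for $i\in\{1,2\}$ and $N\in H^1((\omega_*,\omega^*),\mathbb{R}^3)$, $$H_i[t,N]=\int_{\omega_*}^{\omega^*}\left[\left\langle \frac{dN}{d\omega}(\omega),\Big(\frac{\partial F}{\partial\omega}(t,\omega)e_i\Big)\wedge N(\omega)\right\rangle+\Big\langle e_3,\big(F(t,\omega)e_i\big)\wedge N(\omega)\Big\rangle\right]d\omega .$$ For every $N_0\in H^1((\omega_*,\omega^*),\mathbb{S}^2)$ with $\|N_0+e_3\|_{H^1}\le\delta_1$, the closed-loop system $$\frac{\partial N}{\partial t}(t,\omega)=\sum_{i=1}^2 u_i(t)\,\big[F(t,\omega)e_i\big]\wedge N(t,\omega),\qquad u_i(t)=-H_i[t,N(t)],\qquad N(0,\cdot)=N_0,$$ has a unique solution $N\in C^1\big([0,\infty),H^1((\omega_*,\omega^*),\mathbb{R}^3)\big)$, and $N(t)\rightharpoonup -e_3$ weakly in $H^1$ as $t\to+\infty$. -/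

import Mathlib

open MeasureTheory Set Filter Topology
open scoped Matrix ENNReal Matrix.Norms.L2Operator

noncomputable section

namespace BlochEnsemble

/-- Euclidean space `ℝ³`. -/
abbrev E3 : Type := EuclideanSpace ℝ (Fin 3)

/-- `3 × 3` real matrices, normed by the operator norm associated with the Euclidean norm. -/
abbrev Mat3 : Type := Matrix (Fin 3) (Fin 3) ℝ

/-- The canonical basis of `ℝ³`; `e₁, e₂, e₃` are `e 0, e 1, e 2`. -/
def e (i : Fin 3) : E3 := EuclideanSpace.single i 1

/-- The wedge (cross) product on `ℝ³`. -/
def wedge (x y : E3) : E3 := WithLp.toLp 2 (crossProduct x.ofLp y.ofLp)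

/-- Matrix-vector product on `ℝ³`. -/
def act (A : Mat3) (x : E3) : E3 := WithLp.toLp 2 (A *ᵥ x.ofLp)

/-- Lebesgue measure on the open interval `(a, b)`. -/
abbrev leb (a b : ℝ) : Measure ℝ := volume.restrict (Ioo a b)

/-- `g` is a weak derivative of `f` on the open interval `(a, b)`. -/
def IsWeakDeriv {V : Type*} [NormedAddCommGroup V] [NormedSpace ℝ V] (a b : ℝ) (f g : ℝ → V) :
    Prop :=
  ∀ φ : ℝ → ℝ, ContDiff ℝ (⊤ : ℕ∞) φ → HasCompactSupport φ → tsupport φ ⊆ Ioo a b →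
    ∫ x, deriv φ x • f x ∂(leb a b) = - ∫ x, φ x • g x ∂(leb a b)

/-- The function `f` belongs to `H¹(a, b)`. -/
def MemH1 {V : Type*} [NormedAddCommGroup V] [NormedSpace ℝ V] (a b : ℝ) (f : ℝ → V) : Prop :=
  MemLp f 2 (leb a b) ∧ ∃ g : ℝ → V, MemLp g 2 (leb a b) ∧ IsWeakDeriv a b f g

open Classical in
/-- A weak derivative in `L²(a, b)` of `f`, if there is one (it is then unique almost
everywhere). -/
def weakDeriv {V : Type*} [NormedAddCommGroup V] [NormedSpace ℝ V] (a b : ℝ) (f : ℝ → V) :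
    ℝ → V :=
  if h : ∃ g : ℝ → V, MemLp g 2 (leb a b) ∧ IsWeakDeriv a b f g then Classical.choose h else 0

/-- The `H¹(a, b)` norm of a function that belongs to `H¹(a, b)`. -/
def normH1 {V : Type*} [NormedAddCommGroup V] [NormedSpace ℝ V] (a b : ℝ) (f : ℝ → V) : ℝ :=
  Real.sqrt (∫ x, (‖f x‖ ^ 2 + ‖weakDeriv a b f x‖ ^ 2) ∂(leb a b))

theorem integrable_smul_of_test {φ : ℝ → ℝ} (hc : Continuous φ) (hs : HasCompactSupport φ)
    {a b : ℝ} (f : Lp E3 2 (leb a b)) : Integrable (fun x => φ x • f x) (leb a b) := by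
  have h1 : Integrable f (leb a b) := (Lp.memLp f).integrable (by norm_num)
  obtain ⟨C, hC⟩ := hc.bounded_above_of_compact_support hs
  exact h1.bdd_smul C hc.aestronglyMeasurable (Eventually.of_forall hC)

theorem IsWeakDeriv.congr {a b : ℝ} {f g f' g' : ℝ → E3} (h : IsWeakDeriv a b f g)
    (hf : f =ᵐ[leb a b] f') (hg : g =ᵐ[leb a b] g') : IsWeakDeriv a b f' g' := by
  intro φ h1 h2 h3
  have e1 : ∫ x, deriv φ x • f x ∂(leb a b) = ∫ x, deriv φ x • f' x ∂(leb a b) :=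
    integral_congr_ae (by filter_upwards [hf] with x hx; rw [hx])
  have e2 : ∫ x, φ x • g x ∂(leb a b) = ∫ x, φ x • g' x ∂(leb a b) :=
    integral_congr_ae (by filter_upwards [hg] with x hx; rw [hx])
  rw [← e1, ← e2]
  exact h φ h1 h2 h3

/-- The Hilbert space `H¹((a, b), ℝ³)`, as the space of pairs `(f, f')` in `L² × L²` with `f'` the
weak derivative of `f`.  Its norm is `(∫ ‖f‖² + ‖f'‖²)^(1/2)`. -/
def H1Space (a b : ℝ) : Submodule ℝ (WithLp 2 (Lp E3 2 (leb a b) × Lp E3 2 (leb a b))) where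
  carrier := {p | IsWeakDeriv a b p.fst p.snd}
  zero_mem' := by
    refine IsWeakDeriv.congr (f := 0) (g := 0) ?_ (Lp.coeFn_zero E3 2 _).symm
      (Lp.coeFn_zero E3 2 _).symm
    intro φ _ _ _
    simp
  add_mem' := by
    intro p q hp hq
    refine IsWeakDeriv.congr ?_ (Lp.coeFn_add p.fst q.fst).symm (Lp.coeFn_add p.snd q.snd).symm
    intro φ h1 h2 h3
    have hd : Continuous (deriv φ) := h1.continuous_deriv (by simp)
    simp only [Pi.add_apply, smul_add]
    rw [integral_add (integrable_smul_of_test hd h2.deriv _)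
        (integrable_smul_of_test hd h2.deriv _),
      integral_add (integrable_smul_of_test h1.continuous h2 _)
        (integrable_smul_of_test h1.continuous h2 _), hp φ h1 h2 h3, hq φ h1 h2 h3, neg_add]
  smul_mem' := by
    intro c p hp
    refine IsWeakDeriv.congr ?_ (Lp.coeFn_smul c p.fst).symm (Lp.coeFn_smul c p.snd).symm
    intro φ h1 h2 h3
    simp only [Pi.smul_apply, smul_comm _ c, integral_smul]
    rw [hp φ h1 h2 h3, smul_neg]

/-- The Hilbert space `H¹((a, b), ℝ³)` as a type. -/
abbrev H1 (a b : ℝ) : Type := ↥(H1Space a b)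

/-- The underlying function of an element of `H¹`, defined almost everywhere. -/
def H1.val {a b : ℝ} (N : H1 a b) : ℝ → E3 := N.1.fst

/-- The weak derivative of an element of `H¹`, defined almost everywhere. -/
def H1.der {a b : ℝ} (N : H1 a b) : ℝ → E3 := N.1.snd

/-- The constant function `v`, as an element of `H¹`. -/
def H1.const (a b : ℝ) (v : E3) : H1 a b :=
  ⟨WithLp.toLp 2 (Lp.const 2 (leb a b) v, 0), by
    refine IsWeakDeriv.congr (f := fun _ => v) (g := 0) ?_ (Lp.coeFn_const 2 (leb a b) v).symm
      (Lp.coeFn_zero E3 2 _).symm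
    intro φ h1 h2 h3
    have hd : Continuous (deriv φ) := h1.continuous_deriv (by simp)
    have h0 : ∫ x, deriv φ x ∂(leb a b) = 0 := by
      rw [setIntegral_eq_integral_of_forall_compl_eq_zero]
      · exact integral_eq_zero_of_hasDerivAt_of_integrable
          (fun x => (h1.differentiable (by simp) x).hasDerivAt)
          (hd.integrable_of_hasCompactSupport h2.deriv)
          (h1.continuous.integrable_of_hasCompactSupport h2)
      · intro x hx
        have : x ∉ tsupport (deriv φ) := fun h => hx (h3 (tsupport_deriv_subset h))
        exact image_eq_zero_of_notMem_tsupport this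
    rw [integral_smul_const, h0]
    simp⟩

/-- The `2T`-periodic sign `ε`, equal to `1` on `[2kT, (2k+1)T)` and to `-1` on
`[(2k+1)T, (2k+2)T)`. -/
def eps (T t : ℝ) : ℝ := (-1 : ℝ) ^ ⌊t / T⌋

/-- `σ(t) = ∫₀ᵗ ε(s) ds`. -/
def sigma (T t : ℝ) : ℝ := ∫ s in (0 : ℝ)..t, eps T s

/-- The matrix `S`. -/
def S : Mat3 := !![0, 1, 0; -1, 0, 0; 0, 0, 0]

/-- `F(t, ω) = R(ω) exp(σ(t) ω S)`. -/
def F (T : ℝ) (R : ℝ → Mat3) (t ω : ℝ) : Mat3 :=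
  R ω * NormedSpace.exp ((sigma T t * ω) • S)

/-- The functional `H_i[t, N]`, `i = 1, 2` (here indexed by `0, 1`). -/
def H (a b T : ℝ) (R : ℝ → Mat3) (i : Fin 2) (t : ℝ) (N : H1 a b) : ℝ :=
  ∫ ω, (inner ℝ (N.der ω) (wedge (act (weakDeriv a b (F T R t) ω) (e i.castSucc)) (N.val ω))
    + inner ℝ (e 2) (wedge (act (F T R t ω) (e i.castSucc)) (N.val ω))) ∂(leb a b)

/-- The feedback `u_i(t, N) = -H_i[t, N]`. -/
def u (a b T : ℝ) (R : ℝ → Mat3) (i : Fin 2) (t : ℝ) (N : H1 a b) : ℝ := - H a b T R i t N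

/-- `N ∈ C¹([0, ∞), H¹((a, b), ℝ³))` is a solution of the closed-loop system
`∂N/∂t = ∑ᵢ uᵢ(t, N) (F(t, ω) eᵢ) ∧ N` with `N(0) = N₀` (values at negative times are ignored). -/
def IsSolution (a b T : ℝ) (R : ℝ → Mat3) (N₀ : H1 a b) (N : ℝ → H1 a b) : Prop :=
  N 0 = N₀ ∧ ∃ N' : ℝ → H1 a b, ContinuousOn N' (Ici 0) ∧ ∀ t : ℝ, 0 ≤ t →
    HasDerivWithinAt N (N' t) (Ici 0) t ∧
    ∀ᵐ ω ∂(leb a b), (N' t).val ω =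
      ∑ i : Fin 2, u a b T R i t (N t) • wedge (act (F T R t ω) (e i.castSucc)) ((N t).val ω)

/-- `R` is (the continuous representative of) a map in `H¹((a, b), SO₃(ℝ))` with
`R(ω) M(ω) = -e₃` on `[a, b]`. -/
def IsFrame (a b : ℝ) (M : ℝ → E3) (R : ℝ → Mat3) : Prop :=
  ContinuousOn R (Icc a b) ∧ MemH1 a b R ∧
    ∀ ω ∈ Icc a b, R ω ∈ Matrix.specialOrthogonalGroup (Fin 3) ℝ ∧ act (R ω) (M ω) = -e 2

end BlochEnsemble

end

/-!
The closed-loop system is a gradient-like flow. In the Hilbert space `H¹`, the pointwise identity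
`⟪n, w ∧ n⟫ = 0` turns the functional `H_i[t, N]` into the scalar product `⟪N + e₃, F(t) eᵢ ∧ N⟫`
(`IsFrame.H_eq`). With `y = N + e₃` and `A_i(t)` the bounded operator `N ↦ F(t) eᵢ ∧ N` of `H¹`, the
system reads `y' = -∑ ⟪y, A_i(t) (y - e₃)⟫ A_i(t) (y - e₃)` (`IsFrame.isSolution_iff`), so that
`‖y‖²` decreases at the rate `2 ∑ H_i²`. The field is Lipschitz on balls, which gives global
existence and uniqueness (`exists_global_of_dissipative`, `unique_of_dissipative`). The operators
are continuous and periodic in time, so Barbalat's lemma shows that the outputs tend to `0`; then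
the velocity tends to `0`, and the outputs tend to `0` even when the operators are frozen at any
time `s` (`tendsto_output`).

The trajectory is bounded, so it has a weak limit `N'` along every ultrafilter converging to `+∞`,
and it is enough to show that `N' = -e₃`. The functionals `N ↦ ⟪N + e₃, W ∧ N⟫` are weakly
continuous on bounded sets, since `⟪n, W ∧ n⟫` involves `n'` only linearly and weak convergence in `H¹` implies
uniform convergence (`H1.tendsto_inner_wedgeH1`). Hence `⟪N' + e₃, F(s) eᵢ ∧ N'⟫ = 0` for all `s`.
As `σ(s) = s` on `[0, T]`, differentiating in `s` at `0` gives the same with `F(s) eᵢ` replaced by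
`ω ^ k R e₁` and `ω ^ k R e₂`, for all `k` (`IsFrame.inner_wedge_pow_eq_zero`), and by density of
polynomials by `φ R e₁` and `φ R e₂` with `φ` absolutely continuous
(`H1.integral_density_eq_zero`).

The constant `δ₁` is chosen so that `N'` stays uniformly close to `-e₃`. From `R M = -e₃` one gets
`|⟪R e₃, e₃⟫| = |⟪M, e₃⟫|`, which is bounded below, so `⟪N', R e₃⟫` does not vanish, and
`N' ∧ e₃` is a combination of `R e₁`, `R e₂` and `N'` with absolutely continuous coefficients. The
functional vanishes on the first two terms, and on the third because `N' ∧ N' = 0`. Its value at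
`W = N' ∧ e₃` is `∫ (-N'₃ ‖dN'/dω‖² + 1 - N'₃²)`, where both terms are nonnegative below the
equator; so `N'₃² = 1` and `N' = -e₃` (`H1.eq_neg_e3_of_rigid`).

Elements of `H¹` are handled through their absolutely continuous representatives `H1.rep`, obtained
from the du Bois-Reymond lemma (`ae_const_of_isWeakDeriv_zero`).
-/

noncomputable section

namespace BlochEnsemble

/-! ### Absolutely continuous functions with an integrable derivative -/

section AC

theorem intervalIntegrable_iff_leb {V : Type*} [NormedAddCommGroup V] {a b : ℝ} (hab : a ≤ b)
    {g : ℝ → V} : IntervalIntegrable g volume a b ↔ Integrable g (leb a b) := by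
  rw [intervalIntegrable_iff_integrableOn_Ioo_of_le hab]; rfl

variable {V W Z : Type*} [NormedAddCommGroup V] [NormedSpace ℝ V]
  [NormedAddCommGroup W] [NormedSpace ℝ W] [NormedAddCommGroup Z] [NormedSpace ℝ Z]

/-- A function whose increments are dominated by those of two absolutely continuous functions is
absolutely continuous. -/
theorem absolutelyContinuous_of_dist_le {X Y₁ Y₂ : Type*} [PseudoMetricSpace X]
    [PseudoMetricSpace Y₁] [PseudoMetricSpace Y₂] {a b : ℝ} {k : ℝ → X} {f : ℝ → Y₁} {g : ℝ → Y₂}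
    (hf : AbsolutelyContinuousOnInterval f a b) (hg : AbsolutelyContinuousOnInterval g a b)
    (C : ℝ) (h : ∀ x ∈ uIcc a b, ∀ y ∈ uIcc a b,
      dist (k x) (k y) ≤ C * (dist (f x) (f y) + dist (g x) (g y))) :
    AbsolutelyContinuousOnInterval k a b := by
  unfold AbsolutelyContinuousOnInterval at hf hg ⊢
  refine squeeze_zero' ?_ ?_ (by simpa using (hf.add hg).const_mul C)
  · exact Eventually.of_forall fun _ => Finset.sum_nonneg fun i hi => dist_nonneg
  rw [eventually_inf_principal]
  filter_upwards with (n, I) hnI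
  simp only [← Finset.sum_add_distrib, Finset.mul_sum]
  refine Finset.sum_le_sum fun i hi => ?_
  have := hnI.1 i hi
  exact h _ this.1 _ this.2

theorem ae_uIcc_of_ae_leb {a b : ℝ} (hab : a ≤ b) {P : ℝ → Prop} (h : ∀ᵐ x ∂(leb a b), P x) :
    ∀ᵐ x, x ∈ uIcc a b → P x := by
  rw [uIcc_of_le hab, ← ae_restrict_iff' measurableSet_Icc,
    ← Measure.restrict_congr_set (μ := volume) Ioo_ae_eq_Icc]
  exact h

theorem ae_leb_of_ae_uIcc {a b : ℝ} {P : ℝ → Prop} (h : ∀ᵐ x, x ∈ uIcc a b → P x) :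
    ∀ᵐ x ∂(leb a b), P x := by
  rw [ae_restrict_iff' measurableSet_Ioo]
  filter_upwards [h] with x hx h'
  exact hx (Icc_subset_uIcc (Ioo_subset_Icc_self h'))

theorem ae_leb_mem (a b : ℝ) : ∀ᵐ x ∂(leb a b), x ∈ Ioo a b :=
  ae_restrict_mem measurableSet_Ioo

theorem integral_leb {a b : ℝ} (hab : a ≤ b) (g : ℝ → V) :
    ∫ x, g x ∂(leb a b) = ∫ x in a..b, g x := by
  rw [intervalIntegral.integral_of_le hab, integral_Ioc_eq_integral_Ioo]

/-- `f` is absolutely continuous on `[a, b]`, and `g` is an integrable function equal almost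
everywhere on `(a, b)` to its derivative. -/
structure HasACDeriv (a b : ℝ) (f g : ℝ → V) : Prop where
  ac : AbsolutelyContinuousOnInterval f a b
  integrable : Integrable g (leb a b)
  ae : ∀ᵐ x ∂(leb a b), HasDerivAt f (g x) x

theorem absolutelyContinuous_integral {a b : ℝ} (hab : a ≤ b) {g : ℝ → V}
    (hg : Integrable g (leb a b)) :
    AbsolutelyContinuousOnInterval (fun x => ∫ y in a..x, g y) a b := by
  have hi : IntervalIntegrable g volume a b := (intervalIntegrable_iff_leb hab).2 hg
  have hn := hi.norm.absolutelyContinuousOnInterval_intervalIntegral (c := a) (by simp)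
  refine absolutelyContinuous_of_dist_le hn hn 1 fun x hx y hy => ?_
  have ha : a ∈ uIcc a b := left_mem_uIcc
  have ix : IntervalIntegrable g volume a x := hi.mono_set (uIcc_subset_uIcc ha hx)
  have iy : IntervalIntegrable g volume a y := hi.mono_set (uIcc_subset_uIcc ha hy)
  have h1 : dist (∫ t in a..x, g t) (∫ t in a..y, g t)
      ≤ dist (∫ t in a..x, ‖g t‖) (∫ t in a..y, ‖g t‖) := by
    rw [dist_eq_norm, dist_eq_norm, intervalIntegral.integral_interval_sub_left ix iy,
      intervalIntegral.integral_interval_sub_left ix.norm iy.norm, Real.norm_eq_abs]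
    exact intervalIntegral.norm_integral_le_abs_integral_norm
  have := @dist_nonneg _ _ (∫ t in a..x, ‖g t‖) (∫ t in a..y, ‖g t‖)
  linarith

theorem HasACDeriv.integral [CompleteSpace V] {a b : ℝ} (hab : a ≤ b) {g : ℝ → V}
    (hg : Integrable g (leb a b)) : HasACDeriv a b (fun x => ∫ y in a..x, g y) g := by
  refine ⟨absolutelyContinuous_integral hab hg, hg, ?_⟩
  have hi : IntervalIntegrable g volume a b := (intervalIntegrable_iff_leb hab).2 hg
  refine ae_leb_of_ae_uIcc ?_
  filter_upwards [hi.ae_hasDerivAt_integral] with x hx h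
  exact hx h a left_mem_uIcc

namespace HasACDeriv

variable {a b : ℝ}

theorem continuousOn {f g : ℝ → V} (h : HasACDeriv a b f g) : ContinuousOn f (uIcc a b) :=
  h.ac.continuousOn

theorem continuousOn_Icc {f g : ℝ → V} (h : HasACDeriv a b f g) : ContinuousOn f (Icc a b) :=
  h.continuousOn.mono Icc_subset_uIcc

theorem aestronglyMeasurable {f g : ℝ → V} (h : HasACDeriv a b f g) :
    AEStronglyMeasurable f (leb a b) :=
  (h.continuousOn_Icc.mono Ioo_subset_Icc_self).aestronglyMeasurable measurableSet_Ioo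

theorem exists_bound {f g : ℝ → V} (h : HasACDeriv a b f g) :
    ∃ C, 0 ≤ C ∧ ∀ x ∈ uIcc a b, ‖f x‖ ≤ C := by
  obtain ⟨C, hC⟩ := h.ac.exists_bound
  exact ⟨C, (norm_nonneg _).trans (hC a left_mem_uIcc), hC⟩

theorem exists_ae_bound {f g : ℝ → V} (h : HasACDeriv a b f g) :
    ∃ C, ∀ᵐ x ∂(leb a b), ‖f x‖ ≤ C := by
  obtain ⟨C, _, hC⟩ := h.exists_bound
  refine ⟨C, ?_⟩
  filter_upwards [ae_leb_mem a b] with x hx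
  exact hC x (Icc_subset_uIcc (Ioo_subset_Icc_self hx))

theorem memLp {f g : ℝ → V} (h : HasACDeriv a b f g) (p : ℝ≥0∞) : MemLp f p (leb a b) := by
  obtain ⟨C, hC⟩ := h.exists_ae_bound
  exact MemLp.of_bound h.aestronglyMeasurable C hC

theorem congr_ae {f g g' : ℝ → V} (h : HasACDeriv a b f g) (hg : g =ᵐ[leb a b] g') :
    HasACDeriv a b f g' :=
  ⟨h.ac, h.integrable.congr hg, by filter_upwards [h.ae, hg] with x hx e; rwa [← e]⟩

theorem congr_Icc (hab : a ≤ b) {f f' g : ℝ → V} (h : HasACDeriv a b f g)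
    (hf : ∀ x ∈ Icc a b, f x = f' x) : HasACDeriv a b f' g := by
  refine ⟨absolutelyContinuous_of_dist_le h.ac h.ac 1 fun x hx y hy => ?_, h.integrable, ?_⟩
  · rw [uIcc_of_le hab] at hx hy
    rw [hf x hx, hf y hy]
    have := @dist_nonneg _ _ (f' x) (f' y)
    linarith
  · filter_upwards [h.ae, ae_leb_mem a b] with x hx hm
    refine hx.congr_of_eventuallyEq ?_
    filter_upwards [Ioo_mem_nhds hm.1 hm.2] with y hy
    exact (hf y (Ioo_subset_Icc_self hy)).symm

/-- Two functions that agree on `[a, b]` have almost everywhere the same derivative. -/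
theorem ae_eq {f f' g g' : ℝ → V} (h : HasACDeriv a b f g) (h' : HasACDeriv a b f' g')
    (hf : ∀ x ∈ Icc a b, f x = f' x) : g =ᵐ[leb a b] g' := by
  filter_upwards [h.ae, h'.ae, ae_leb_mem a b] with x hx hx' hm
  refine hx.unique (hx'.congr_of_eventuallyEq ?_)
  filter_upwards [Ioo_mem_nhds hm.1 hm.2] with y hy
  exact hf y (Ioo_subset_Icc_self hy)

theorem const (v : V) : HasACDeriv a b (fun _ => v) (fun _ => (0 : V)) := by
  refine ⟨?_, integrable_zero _ _ _, Eventually.of_forall fun x => hasDerivAt_const x v⟩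
  refine LipschitzOnWith.absolutelyContinuousOnInterval (K := 0) fun x _ y _ => by simp

theorem of_contDiff {f : ℝ → V} (h : ContDiff ℝ 1 f) : HasACDeriv a b f (deriv f) := by
  refine ⟨?_, ?_, ?_⟩
  · exact h.contDiffOn.absolutelyContinuousOnInterval
  · exact ((h.continuous_deriv le_rfl).integrableOn_Icc).mono_set Ioo_subset_Icc_self
  · exact Eventually.of_forall fun x => (h.differentiable (by simp) x).hasDerivAt

theorem add {f g f' g' : ℝ → V} (h : HasACDeriv a b f g) (h' : HasACDeriv a b f' g') :
    HasACDeriv a b (fun x => f x + f' x) (fun x => g x + g' x) :=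
  ⟨h.ac.add h'.ac, h.integrable.add h'.integrable, by
    filter_upwards [h.ae, h'.ae] with x hx hx' using hx.add hx'⟩

theorem sub {f g f' g' : ℝ → V} (h : HasACDeriv a b f g) (h' : HasACDeriv a b f' g') :
    HasACDeriv a b (fun x => f x - f' x) (fun x => g x - g' x) :=
  ⟨h.ac.sub h'.ac, h.integrable.sub h'.integrable, by
    filter_upwards [h.ae, h'.ae] with x hx hx' using hx.sub hx'⟩

theorem clm {f g : ℝ → V} (h : HasACDeriv a b f g) (A : V →L[ℝ] W) :
    HasACDeriv a b (fun x => A (f x)) (fun x => A (g x)) := by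
  refine ⟨absolutelyContinuous_of_dist_le h.ac h.ac ‖A‖ fun x _ y _ => ?_,
    A.integrable_comp h.integrable, ?_⟩
  · rw [dist_eq_norm, ← map_sub, dist_eq_norm]
    exact (A.le_opNorm _).trans (by gcongr; linarith [norm_nonneg (f x - f y)])
  · filter_upwards [h.ae] with x hx using A.hasFDerivAt.comp_hasDerivAt x hx

/-- The product rule for a continuous bilinear product. -/
theorem bilin {f g : ℝ → V} {f' g' : ℝ → W} (h : HasACDeriv a b f g) (h' : HasACDeriv a b f' g')
    (B : V →L[ℝ] W →L[ℝ] Z) :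
    HasACDeriv a b (fun x => B (f x) (f' x)) (fun x => B (f x) (g' x) + B (g x) (f' x)) := by
  obtain ⟨C, hC0, hC⟩ := h.exists_bound
  obtain ⟨C', hC0', hC'⟩ := h'.exists_bound
  obtain ⟨D, hD⟩ := h.exists_ae_bound
  obtain ⟨D', hD'⟩ := h'.exists_ae_bound
  refine ⟨absolutelyContinuous_of_dist_le h.ac h'.ac (‖B‖ * (C + C')) fun x hx y hy => ?_,
    ?_, ?_⟩
  · have e : B (f x) (f' x) - B (f y) (f' y) = B (f x - f y) (f' x) + B (f y) (f' x - f' y) := by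
      simp
    rw [dist_eq_norm, e, dist_eq_norm, dist_eq_norm]
    refine (norm_add_le _ _).trans ?_
    have h1 := B.le_opNorm₂ (f x - f y) (f' x)
    have h2 := B.le_opNorm₂ (f y) (f' x - f' y)
    have h3 : ‖B‖ * ‖f x - f y‖ * ‖f' x‖ ≤ ‖B‖ * ‖f x - f y‖ * C' := by gcongr; exact hC' x hx
    have h4 : ‖B‖ * ‖f y‖ * ‖f' x - f' y‖ ≤ ‖B‖ * C * ‖f' x - f' y‖ := by gcongr; exact hC y hy
    have h5 : 0 ≤ ‖B‖ * ‖f x - f y‖ * C := by positivity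
    have h6 : 0 ≤ ‖B‖ * C' * ‖f' x - f' y‖ := by positivity
    nlinarith
  · exact (B.integrable_of_bilin_of_bdd_left D h.aestronglyMeasurable hD h'.integrable).add
      (B.integrable_of_bilin_of_bdd_right D' h.integrable h'.aestronglyMeasurable hD')
  · filter_upwards [h.ae, h'.ae] with x hx hx'
    exact B.hasDerivAt_of_bilinear (fun _ => hx) (fun _ => hx')

theorem smul {φ φ' : ℝ → ℝ} {f g : ℝ → V} (hφ : HasACDeriv a b φ φ') (h : HasACDeriv a b f g) :
    HasACDeriv a b (fun x => φ x • f x) (fun x => φ x • g x + φ' x • f x) :=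
  hφ.bilin h (ContinuousLinearMap.lsmul ℝ ℝ)

theorem inner {V : Type*} [NormedAddCommGroup V] [InnerProductSpace ℝ V] {f g f' g' : ℝ → V}
    (h : HasACDeriv a b f g) (h' : HasACDeriv a b f' g') :
    HasACDeriv a b (fun x => inner ℝ (f x) (f' x))
      (fun x => inner ℝ (f x) (g' x) + inner ℝ (g x) (f' x)) :=
  h.bilin h' (innerSL ℝ)

/-- The quotient rule, for a function bounded away from `0`. -/
theorem inv {θ θ' : ℝ → ℝ} (h : HasACDeriv a b θ θ') {c : ℝ} (hc : 0 < c)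
    (hθ : ∀ x ∈ uIcc a b, c ≤ |θ x|) :
    HasACDeriv a b (fun x => (θ x)⁻¹) (fun x => -θ' x / θ x ^ 2) := by
  have hne : ∀ x ∈ uIcc a b, θ x ≠ 0 := fun x hx h0 => by
    have := hθ x hx; rw [h0, abs_zero] at this; linarith
  refine ⟨absolutelyContinuous_of_dist_le h.ac h.ac (1 / c ^ 2) fun x hx y hy => ?_, ?_, ?_⟩
  · have hx0 := hne x hx
    have hy0 := hne y hy
    have e : (θ x)⁻¹ - (θ y)⁻¹ = (θ y - θ x) / (θ x * θ y) := by field_simp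
    rw [Real.dist_eq, e, abs_div, abs_mul, Real.dist_eq, abs_sub_comm (θ y)]
    have h1 : c ^ 2 ≤ |θ x| * |θ y| := by
      rw [sq]; exact mul_le_mul (hθ x hx) (hθ y hy) hc.le (abs_nonneg _)
    rw [div_mul_eq_mul_div, one_mul]
    gcongr
    linarith [abs_nonneg (θ x - θ y)]
  · have hcont : ContinuousOn (fun x => (θ x ^ 2)⁻¹) (uIcc a b) :=
      (h.continuousOn.pow 2).inv₀ fun x hx => pow_ne_zero 2 (hne x hx)
    have hm : AEStronglyMeasurable (fun x => (θ x ^ 2)⁻¹) (leb a b) :=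
      (hcont.mono (Ioo_subset_Icc_self.trans Icc_subset_uIcc)).aestronglyMeasurable
        measurableSet_Ioo
    have hb : ∀ᵐ x ∂(leb a b), ‖(θ x ^ 2)⁻¹‖ ≤ (c ^ 2)⁻¹ := by
      filter_upwards [ae_leb_mem a b] with x hx
      have := hθ x (Icc_subset_uIcc (Ioo_subset_Icc_self hx))
      rw [norm_inv, norm_pow, Real.norm_eq_abs]
      gcongr
    simpa [div_eq_mul_inv] using h.integrable.neg.mul_bdd hm hb
  · filter_upwards [h.ae, ae_leb_mem a b] with x hx hm
    exact hx.inv (hne x (Icc_subset_uIcc (Ioo_subset_Icc_self hm)))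

theorem mono {f g : ℝ → V} (h : HasACDeriv a b f g) {x y : ℝ} (hx : a ≤ x) (hxy : x ≤ y)
    (hy : y ≤ b) : HasACDeriv x y f g := by
  refine ⟨h.ac.mono ?_, h.integrable.mono_measure ?_, ?_⟩
  · rw [uIcc_of_le hxy, uIcc_of_le (hx.trans (hxy.trans hy))]; exact Icc_subset_Icc hx hy
  · exact Measure.restrict_mono_set _ (Ioo_subset_Ioo hx hy)
  · exact ae_mono (Measure.restrict_mono_set _ (Ioo_subset_Ioo hx hy)) h.ae

/-- The fundamental theorem of calculus. -/
theorem integral_eq_sub [CompleteSpace V] (hab : a ≤ b) {f g : ℝ → V} (h : HasACDeriv a b f g) :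
    ∫ x, g x ∂(leb a b) = f b - f a := by
  -- The difference of `f` and the primitive of `g` has zero derivative, so it is constant.
  have h0 := h.sub (HasACDeriv.integral hab h.integrable)
  obtain ⟨C, hC⟩ := h0.ac.const_of_ae_hasDerivAt_zero
    (ae_uIcc_of_ae_leb hab (h0.ae.mono fun x hx => by simpa using hx))
  have ha := hC a left_mem_uIcc
  have hb := hC b right_mem_uIcc
  simp only [intervalIntegral.integral_same, sub_zero] at ha
  rw [integral_leb hab, ha, ← hb]
  abel

/-- Integration by parts against test functions. -/
theorem isWeakDeriv [CompleteSpace V] (hab : a ≤ b) {f g : ℝ → V} (h : HasACDeriv a b f g) :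
    IsWeakDeriv a b f g := by
  intro φ h1 h2 h3
  have hφ : HasACDeriv a b φ (deriv φ) := of_contDiff (h1.of_le (by simp))
  have hp := hφ.smul h
  have z : ∀ x, x ∉ Ioo a b → φ x = 0 := fun x hx =>
    image_eq_zero_of_notMem_tsupport fun h => hx (h3 h)
  have hint := hp.integral_eq_sub hab
  obtain ⟨C, hC⟩ := h.exists_ae_bound
  obtain ⟨D, hD⟩ := hφ.exists_ae_bound
  rw [z a (by simp), z b (by simp), zero_smul, zero_smul, sub_zero, integral_add] at hint
  · exact eq_neg_of_add_eq_zero_right hint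
  · exact (ContinuousLinearMap.lsmul ℝ ℝ).integrable_of_bilin_of_bdd_left D
      hφ.aestronglyMeasurable hD h.integrable
  · exact (ContinuousLinearMap.lsmul ℝ ℝ).integrable_of_bilin_of_bdd_right C
      hφ.integrable h.aestronglyMeasurable hC

end HasACDeriv

/-! ### Weak derivatives -/

theorem IsWeakDeriv.clm [CompleteSpace V] [CompleteSpace W] {a b : ℝ} {f g : ℝ → V}
    (h : IsWeakDeriv a b f g) (hf : Integrable f (leb a b)) (hg : Integrable g (leb a b))
    (A : V →L[ℝ] W) :
    IsWeakDeriv a b (fun x => A (f x)) (fun x => A (g x)) := by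
  intro φ h1 h2 h3
  have key : ∀ {ψ : ℝ → ℝ} {k : ℝ → V}, Continuous ψ → HasCompactSupport ψ →
      Integrable k (leb a b) → ∫ x, ψ x • A (k x) ∂(leb a b) = A (∫ x, ψ x • k x ∂(leb a b)) := by
    intro ψ k hψ hs hk
    obtain ⟨C, hC⟩ := hψ.bounded_above_of_compact_support hs
    have hi : Integrable (fun x => ψ x • k x) (leb a b) :=
      hk.bdd_smul C hψ.aestronglyMeasurable (Eventually.of_forall hC)
    rw [← A.integral_comp_comm hi]
    simp
  rw [key (h1.continuous_deriv (by simp)) h2.deriv hf, key h1.continuous h2 hg, h φ h1 h2 h3,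
    map_neg]

theorem IsWeakDeriv.ae_unique [CompleteSpace V] {a b : ℝ} {f f' g g' : ℝ → V}
    (hff : f =ᵐ[leb a b] f')
    (h : IsWeakDeriv a b f g) (h' : IsWeakDeriv a b f' g') (hg : Integrable g (leb a b))
    (hg' : Integrable g' (leb a b)) : g =ᵐ[leb a b] g' := by
  have hs : ∀ᵐ x, x ∈ Ioo a b → (fun y => g y - g' y) x = 0 := by
    refine isOpen_Ioo.ae_eq_zero_of_integral_contDiff_smul_eq_zero
      (IntegrableOn.locallyIntegrableOn (hg.sub hg')) ?_
    intro φ h1 h2 h3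
    obtain ⟨C, hC⟩ := h1.continuous.bounded_above_of_compact_support h2
    have hi : ∀ {k : ℝ → V}, Integrable k (leb a b) →
        Integrable (fun x => φ x • k x) (leb a b) := fun hk =>
      hk.bdd_smul C h1.continuous.aestronglyMeasurable (Eventually.of_forall hC)
    have e : ∫ x, deriv φ x • f x ∂(leb a b) = ∫ x, deriv φ x • f' x ∂(leb a b) :=
      integral_congr_ae (by filter_upwards [hff] with x hx; rw [hx])
    have h4 := h φ h1 h2 h3
    have h5 := h' φ h1 h2 h3
    rw [e, h5, neg_inj] at h4
    have h6 : ∫ x, φ x • (g x - g' x) ∂(leb a b) = 0 := by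
      simp only [smul_sub]
      rw [integral_sub (hi hg) (hi hg'), h4, sub_self]
    rw [← h6, eq_comm, setIntegral_eq_integral_of_forall_compl_eq_zero]
    intro x hx
    rw [image_eq_zero_of_notMem_tsupport fun h => hx (h3 h), zero_smul]
  rw [Filter.EventuallyEq, ae_restrict_iff' measurableSet_Ioo]
  filter_upwards [hs] with x hx h
  exact sub_eq_zero.1 (hx h)

end AC

section DuBoisReymond

variable {V : Type*} [NormedAddCommGroup V] [NormedSpace ℝ V] [CompleteSpace V]

/-- A smooth function compactly supported in `(a, b)` with zero integral is the derivative of such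
a function. -/
theorem exists_test_primitive {a b : ℝ} (hab : a < b) {η : ℝ → ℝ} (h1 : ContDiff ℝ (⊤ : ℕ∞) η)
    (h2 : HasCompactSupport η) (h3 : tsupport η ⊆ Ioo a b) (h0 : ∫ x, η x = 0) :
    ∃ ψ : ℝ → ℝ, ContDiff ℝ (⊤ : ℕ∞) ψ ∧ HasCompactSupport ψ ∧ tsupport ψ ⊆ Ioo a b ∧
      deriv ψ = η := by
  obtain ⟨α, β, hα, hβ, hz⟩ : ∃ α β, a < α ∧ β < b ∧ ∀ x, x ∉ Icc α β → η x = 0 := by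
    have hK : IsCompact (tsupport η ∪ {(a + b) / 2}) := h2.isCompact.union isCompact_singleton
    have hne : (tsupport η ∪ {(a + b) / 2}).Nonempty := ⟨_, Or.inr rfl⟩
    have hsub : tsupport η ∪ {(a + b) / 2} ⊆ Ioo a b :=
      union_subset h3 (singleton_subset_iff.2 ⟨by linarith, by linarith⟩)
    obtain ⟨α, hα⟩ := hK.exists_isLeast hne
    obtain ⟨β, hβ⟩ := hK.exists_isGreatest hne
    refine ⟨α, β, (hsub hα.1).1, (hsub hβ.1).2, fun x hx => ?_⟩
    refine image_eq_zero_of_notMem_tsupport fun h => hx ⟨hα.2 (Or.inl h), hβ.2 (Or.inl h)⟩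
  have hc : Continuous η := h1.continuous
  have hd : ∀ x, HasDerivAt (fun x => ∫ y in a..x, η y) (η x) x := fun x =>
    intervalIntegral.integral_hasDerivAt_right (hc.intervalIntegrable _ _)
      (hc.stronglyMeasurableAtFilter _ _) hc.continuousAt
  have hder : deriv (fun x => ∫ y in a..x, η y) = η := funext fun x => (hd x).deriv
  have hsupp : ∀ x, x ∉ Icc α β → ∫ y in a..x, η y = 0 := by
    intro x hx
    rcases not_and_or.1 hx with h | h
    · rw [intervalIntegral.integral_congr (g := fun _ => (0 : ℝ)), intervalIntegral.integral_zero]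
      intro y hy
      have : y < α := lt_of_le_of_lt hy.2 (max_lt hα (not_le.1 h))
      exact hz y fun h' => absurd h'.1 (not_le.2 this)
    · rw [not_le] at h
      by_cases hαβ : α ≤ β
      · rw [← h0, intervalIntegral.integral_of_le (by linarith)]
        refine setIntegral_eq_integral_of_forall_compl_eq_zero fun y hy => hz y fun h' => hy ?_
        exact ⟨by linarith [h'.1], by linarith [h'.2]⟩
      · simp [fun y => hz y fun h' => hαβ (h'.1.trans h'.2)]
  have hts : tsupport (fun x => ∫ y in a..x, η y) ⊆ Icc α β := by
    refine closure_minimal (fun x hx => ?_) isClosed_Icc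
    by_contra h
    exact hx (hsupp x h)
  refine ⟨_, contDiff_infty_iff_deriv.2 ⟨fun x => (hd x).differentiableAt, by rwa [hder]⟩, ?_,
    hts.trans (Icc_subset_Ioo hα hβ), hder⟩
  exact isCompact_Icc.of_isClosed_subset (isClosed_tsupport _) hts

/-- The du Bois-Reymond lemma: a function with zero weak derivative is constant. A test function
differs from the derivative of a test function by a multiple of a fixed bump `ρ` of integral `1`,
so the constant is `∫ ρ f`. -/
theorem ae_const_of_isWeakDeriv_zero {a b : ℝ} (hab : a < b) {f : ℝ → V}
    (hf : Integrable f (leb a b)) (h : IsWeakDeriv a b f (fun _ => 0)) :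
    ∃ c, f =ᵐ[leb a b] fun _ => c := by
  let ρ₀ : ContDiffBump ((a + b) / 2 : ℝ) :=
    ⟨(b - a) / 8, (b - a) / 4, by linarith, by linarith⟩
  set ρ : ℝ → ℝ := ρ₀.normed volume with hρ
  have r1 : ContDiff ℝ (⊤ : ℕ∞) ρ := ρ₀.contDiff_normed
  have r2 : HasCompactSupport ρ := ρ₀.hasCompactSupport_normed
  have r3 : tsupport ρ ⊆ Ioo a b := by
    rw [hρ, ρ₀.tsupport_normed_eq, Real.closedBall_eq_Icc]
    refine Icc_subset_Ioo ?_ ?_ <;> simp only [ρ₀] <;> linarith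
  have r0 : ∫ x, ρ x = 1 := ρ₀.integral_normed
  have hi : ∀ {φ : ℝ → ℝ}, ContDiff ℝ (⊤ : ℕ∞) φ → HasCompactSupport φ → ∀ {k : ℝ → V},
      Integrable k (leb a b) → Integrable (fun x => φ x • k x) (leb a b) := by
    intro φ h1 h2 k hk
    obtain ⟨C, hC⟩ := h1.continuous.bounded_above_of_compact_support h2
    exact hk.bdd_smul C h1.continuous.aestronglyMeasurable (Eventually.of_forall hC)
  set c : V := ∫ x, ρ x • f x ∂(leb a b) with hc
  refine ⟨c, ?_⟩
  have hs : ∀ᵐ x, x ∈ Ioo a b → (fun y => f y - c) x = 0 := by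
    refine isOpen_Ioo.ae_eq_zero_of_integral_contDiff_smul_eq_zero
      (IntegrableOn.locallyIntegrableOn (hf.sub (integrable_const c))) ?_
    intro φ h1 h2 h3
    have hφi : Integrable φ := h1.continuous.integrable_of_hasCompactSupport h2
    have hρi : Integrable ρ := r1.continuous.integrable_of_hasCompactSupport r2
    set m : ℝ := ∫ x, φ x with hm
    have e1 : ContDiff ℝ (⊤ : ℕ∞) (fun x => φ x - m * ρ x) := h1.sub (contDiff_const.mul r1)
    have s1 : tsupport (fun x => φ x - m * ρ x) ⊆ tsupport φ ∪ tsupport ρ := by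
      refine closure_minimal (fun x hx => ?_)
        ((isClosed_tsupport _).union (isClosed_tsupport _))
      by_contra hn
      simp only [mem_union, not_or] at hn
      exact hx (by simp [image_eq_zero_of_notMem_tsupport hn.1,
        image_eq_zero_of_notMem_tsupport hn.2])
    have e2 : HasCompactSupport (fun x => φ x - m * ρ x) :=
      (h2.isCompact.union r2.isCompact).of_isClosed_subset (isClosed_tsupport _) s1
    have e3 : tsupport (fun x => φ x - m * ρ x) ⊆ Ioo a b := s1.trans (union_subset h3 r3)
    have e0 : ∫ x, (φ x - m * ρ x) = 0 := by
      rw [integral_sub hφi (hρi.const_mul m), integral_const_mul, r0, mul_one, sub_self]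
    obtain ⟨ψ, p1, p2, p3, p4⟩ := exists_test_primitive hab e1 e2 e3 e0
    have h4 := h ψ p1 p2 p3
    simp only [p4, smul_zero, integral_zero, neg_zero, sub_smul, mul_smul] at h4
    rw [integral_sub (hi h1 h2 hf) (g := fun x => m • ρ x • f x) ((hi r1 r2 hf).smul m),
      integral_smul, ← hc] at h4
    have h5 : ∫ x, φ x • (f x - c) ∂(leb a b) = 0 := by
      simp only [smul_sub]
      rw [integral_sub (hi h1 h2 hf) (hi h1 h2 (integrable_const c)), integral_smul_const]
      rw [show ∫ x, φ x ∂(leb a b) = m from setIntegral_eq_integral_of_forall_compl_eq_zero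
        fun x hx => image_eq_zero_of_notMem_tsupport fun h => hx (h3 h)]
      exact h4
    rw [← h5, eq_comm, setIntegral_eq_integral_of_forall_compl_eq_zero]
    intro x hx
    rw [image_eq_zero_of_notMem_tsupport fun h => hx (h3 h), zero_smul]
  rw [Filter.EventuallyEq, ae_restrict_iff' measurableSet_Ioo]
  filter_upwards [hs] with x hx h
  exact sub_eq_zero.1 (hx h)

/-- A function with an integrable weak derivative has an absolutely continuous representative. -/
theorem IsWeakDeriv.exists_hasACDeriv {a b : ℝ} (hab : a < b) {f g : ℝ → V}
    (h : IsWeakDeriv a b f g) (hf : Integrable f (leb a b)) (hg : Integrable g (leb a b)) :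
    ∃ F, HasACDeriv a b F g ∧ F =ᵐ[leb a b] f := by
  have hp := HasACDeriv.integral hab.le hg
  have hpi : Integrable (fun x => ∫ y in a..x, g y) (leb a b) :=
    memLp_one_iff_integrable.1 (hp.memLp 1)
  have hw : IsWeakDeriv a b (fun x => f x - ∫ y in a..x, g y) (fun _ => 0) := by
    intro φ h1 h2 h3
    have hi : ∀ {k : ℝ → V}, Integrable k (leb a b) →
        Integrable (fun x => deriv φ x • k x) (leb a b) := by
      intro k hk
      have hd : Continuous (deriv φ) := h1.continuous_deriv (by simp)
      obtain ⟨C, hC⟩ := hd.bounded_above_of_compact_support h2.deriv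
      exact hk.bdd_smul C hd.aestronglyMeasurable (Eventually.of_forall hC)
    simp only [smul_sub]
    rw [integral_sub (hi hf) (hi hpi), h φ h1 h2 h3, hp.isWeakDeriv hab.le φ h1 h2 h3]
    simp
  obtain ⟨c, hc⟩ := ae_const_of_isWeakDeriv_zero hab (hf.sub hpi) hw
  refine ⟨fun x => c + ∫ y in a..x, g y, ?_, ?_⟩
  · exact ((HasACDeriv.const c).add hp).congr_ae (Eventually.of_forall fun x => by simp)
  · filter_upwards [hc] with x hx
    rw [← hx, Pi.sub_apply, sub_add_cancel]

theorem eqOn_Icc_of_ae_eq_leb {V : Type*} [TopologicalSpace V] [T2Space V] {a b : ℝ} (hab : a < b)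
    {f g : ℝ → V} (h : f =ᵐ[leb a b] g) (hf : ContinuousOn f (Icc a b))
    (hg : ContinuousOn g (Icc a b)) : ∀ x ∈ Icc a b, f x = g x := by
  refine Measure.eqOn_Icc_of_ae_eq volume hab.ne ?_ hf hg
  rwa [← Measure.restrict_congr_set (μ := volume) Ioo_ae_eq_Icc]

theorem IsWeakDeriv.hasACDeriv {a b : ℝ} (hab : a < b) {f g : ℝ → V}
    (h : IsWeakDeriv a b f g) (hf : ContinuousOn f (Icc a b)) (hg : Integrable g (leb a b)) :
    HasACDeriv a b f g := by
  have hi : Integrable f (leb a b) := (hf.integrableOn_Icc).mono_set Ioo_subset_Icc_self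
  obtain ⟨F, hF, he⟩ := h.exists_hasACDeriv hab hi hg
  exact hF.congr_Icc hab.le (eqOn_Icc_of_ae_eq_leb hab he hF.continuousOn_Icc hf)

end DuBoisReymond

/-! ### The space `H¹` -/

namespace H1

theorem memLp_val {a b : ℝ} (N : H1 a b) : MemLp N.val 2 (leb a b) := Lp.memLp _

theorem memLp_der {a b : ℝ} (N : H1 a b) : MemLp N.der 2 (leb a b) := Lp.memLp _

theorem integrable_val {a b : ℝ} (N : H1 a b) : Integrable N.val (leb a b) :=
  N.memLp_val.integrable (by norm_num)

theorem integrable_der {a b : ℝ} (N : H1 a b) : Integrable N.der (leb a b) :=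
  N.memLp_der.integrable (by norm_num)

variable {a b : ℝ} [hab : Fact (a < b)]

theorem exists_rep (N : H1 a b) : ∃ F, HasACDeriv a b F N.der ∧ F =ᵐ[leb a b] N.val :=
  IsWeakDeriv.exists_hasACDeriv hab.out N.2 N.integrable_val N.integrable_der

/-- The absolutely continuous representative of an element of `H¹`. -/
def rep (N : H1 a b) : ℝ → E3 := N.exists_rep.choose

theorem rep_ac (N : H1 a b) : HasACDeriv a b N.rep N.der := N.exists_rep.choose_spec.1

theorem rep_ae (N : H1 a b) : N.rep =ᵐ[leb a b] N.val := N.exists_rep.choose_spec.2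

theorem rep_eq (N : H1 a b) {f : ℝ → E3} (hf : ContinuousOn f (Icc a b))
    (h : N.val =ᵐ[leb a b] f) {x : ℝ} (hx : x ∈ Icc a b) : N.rep x = f x :=
  eqOn_Icc_of_ae_eq_leb hab.out (N.rep_ae.trans h) N.rep_ac.continuousOn_Icc hf x hx

omit hab in
theorem ext_val {N M : H1 a b} (h : N.val =ᵐ[leb a b] M.val) : N = M := by
  have hd : N.der =ᵐ[leb a b] M.der :=
    IsWeakDeriv.ae_unique h N.2 M.2 N.integrable_der M.integrable_der
  refine Subtype.ext ((WithLp.equiv 2 _).injective (Prod.ext ?_ ?_))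
  · exact Lp.ext h
  · exact Lp.ext hd

theorem ext_rep {N M : H1 a b} (h : ∀ x ∈ Icc a b, N.rep x = M.rep x) : N = M := by
  refine ext_val ?_
  filter_upwards [N.rep_ae, M.rep_ae, ae_leb_mem a b] with x h1 h2 hx
  rw [← h1, ← h2, h x (Ioo_subset_Icc_self hx)]

theorem rep_add (N M : H1 a b) {x : ℝ} (hx : x ∈ Icc a b) :
    (N + M).rep x = N.rep x + M.rep x := by
  refine (N + M).rep_eq (f := fun x => N.rep x + M.rep x)
    (N.rep_ac.continuousOn_Icc.add M.rep_ac.continuousOn_Icc) ?_ hx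
  filter_upwards [N.rep_ae, M.rep_ae, Lp.coeFn_add N.1.fst M.1.fst] with y h1 h2 h3
  rw [h1, h2]
  exact h3

theorem rep_smul (c : ℝ) (N : H1 a b) {x : ℝ} (hx : x ∈ Icc a b) :
    (c • N).rep x = c • N.rep x := by
  refine (c • N).rep_eq (f := fun x => c • N.rep x) (N.rep_ac.continuousOn_Icc.const_smul c) ?_ hx
  filter_upwards [N.rep_ae, Lp.coeFn_smul c N.1.fst] with y h1 h3
  rw [h1]
  exact h3

theorem rep_const (v : E3) {x : ℝ} (hx : x ∈ Icc a b) : (H1.const a b v).rep x = v :=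
  (H1.const a b v).rep_eq (f := fun _ => v) continuousOn_const (Lp.coeFn_const 2 (leb a b) v) hx

omit hab in
theorem der_const (v : E3) : (H1.const a b v).der =ᵐ[leb a b] fun _ => 0 :=
  Lp.coeFn_zero E3 2 (leb a b)

/-- The element of `H¹` given by an absolutely continuous function with derivative in `L²`. -/
def ofAC (f g : ℝ → E3) (h : HasACDeriv a b f g) (hg : MemLp g 2 (leb a b)) : H1 a b :=
  ⟨WithLp.toLp 2 ((h.memLp 2).toLp f, hg.toLp g),
    (h.isWeakDeriv hab.out.le).congr (h.memLp 2).coeFn_toLp.symm hg.coeFn_toLp.symm⟩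

theorem der_ofAC {f g : ℝ → E3} (h : HasACDeriv a b f g) (hg : MemLp g 2 (leb a b)) :
    (ofAC f g h hg).der =ᵐ[leb a b] g := hg.coeFn_toLp

theorem rep_ofAC {f g : ℝ → E3} (h : HasACDeriv a b f g) (hg : MemLp g 2 (leb a b)) {x : ℝ}
    (hx : x ∈ Icc a b) : (ofAC f g h hg).rep x = f x :=
  (ofAC f g h hg).rep_eq h.continuousOn_Icc (h.memLp 2).coeFn_toLp hx

omit hab in
theorem inner_eq (N M : H1 a b) :
    inner ℝ N M = ∫ x, inner ℝ (N.val x) (M.val x) ∂(leb a b)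
      + ∫ x, inner ℝ (N.der x) (M.der x) ∂(leb a b) := by
  rw [Submodule.coe_inner, WithLp.prod_inner_apply, L2.inner_def, L2.inner_def]
  rfl

omit hab in
theorem norm_fst_le (N : H1 a b) : ‖N.1.fst‖ ≤ ‖N‖ := WithLp.norm_fst_le _ _

omit hab in
theorem norm_snd_le (N : H1 a b) : ‖N.1.snd‖ ≤ ‖N‖ := WithLp.norm_snd_le _ _

end H1

theorem integral_norm_le_sqrt {V : Type*} [NormedAddCommGroup V] {x y : ℝ} (hxy : x ≤ y)
    {f : ℝ → V} (hf : MemLp f 2 (leb x y)) :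
    ∫ t, ‖f t‖ ∂(leb x y) ≤ √(y - x) * (eLpNorm f 2 (leb x y)).toReal := by
  have h := eLpNorm_le_eLpNorm_mul_rpow_measure_univ (μ := leb x y) (p := 1) (q := 2)
    (by norm_num) hf.1
  rw [eLpNorm_one_eq_lintegral_enorm] at h
  have h2 := ENNReal.toReal_mono (ENNReal.mul_ne_top hf.2.ne (by simp; norm_num)) h
  rw [← integral_norm_eq_lintegral_enorm hf.1, ENNReal.toReal_mul, mul_comm] at h2
  convert h2 using 2
  rw [← ENNReal.toReal_rpow, Measure.restrict_apply_univ, Real.volume_Ioo,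
    ENNReal.toReal_ofReal (by linarith), Real.sqrt_eq_rpow]
  norm_num

namespace H1

variable {a b : ℝ} [hab : Fact (a < b)]

/-- Elements of `H¹` are Hölder continuous of exponent `1/2`. -/
theorem norm_rep_sub_le (N : H1 a b) {x y : ℝ} (hx : x ∈ Icc a b) (hy : y ∈ Icc a b) :
    ‖N.rep x - N.rep y‖ ≤ √|x - y| * ‖N‖ := by
  wlog hxy : y ≤ x generalizing x y
  · rw [norm_sub_rev, abs_sub_comm]
    exact this hy hx (not_le.1 hxy).le
  rw [← (N.rep_ac.mono hy.1 hxy hx.2).integral_eq_sub hxy, abs_of_nonneg (by linarith)]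
  have hle : leb y x ≤ leb a b := Measure.restrict_mono_set _ (Ioo_subset_Ioo hy.1 hx.2)
  refine (norm_integral_le_integral_norm _).trans
    ((integral_norm_le_sqrt hxy (N.memLp_der.mono_measure hle)).trans ?_)
  gcongr
  refine le_trans ?_ N.norm_snd_le
  rw [Lp.norm_def]
  exact ENNReal.toReal_mono (Lp.eLpNorm_ne_top _) (eLpNorm_mono_measure _ hle)

/-- The Sobolev embedding of `H¹` into bounded functions, by averaging the Hölder estimate over
the interval. -/
theorem exists_norm_rep_le (a b : ℝ) [hab : Fact (a < b)] :
    ∃ K : ℝ, 0 < K ∧ ∀ (N : H1 a b), ∀ x ∈ Icc a b, ‖N.rep x‖ ≤ K * ‖N‖ := by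
  have hlt : 0 < b - a := sub_pos.2 hab.out
  refine ⟨(b - a)⁻¹ * √(b - a) + √(b - a), by positivity, fun N x hx => ?_⟩
  have h1 : ∀ᵐ y ∂(leb a b), ‖N.rep x‖ ≤ ‖N.val y‖ + √(b - a) * ‖N‖ := by
    filter_upwards [N.rep_ae, ae_leb_mem a b] with y hy hm
    have hm' := Ioo_subset_Icc_self hm
    have h2 := N.norm_rep_sub_le hx hm'
    have h3 : √|x - y| ≤ √(b - a) := by
      refine Real.sqrt_le_sqrt (abs_le.2 ⟨?_, ?_⟩) <;> linarith [hx.1, hx.2, hm'.1, hm'.2]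
    have h4 : √|x - y| * ‖N‖ ≤ √(b - a) * ‖N‖ := by gcongr
    rw [← hy]
    have := norm_le_norm_add_norm_sub (N.rep y) (N.rep x)
    rw [norm_sub_rev] at this
    linarith
  have h2 := integral_mono_ae (integrable_const _)
    (g := fun y => ‖N.val y‖ + √(b - a) * ‖N‖)
    ((N.integrable_val.norm).add (integrable_const _)) h1
  rw [integral_add N.integrable_val.norm (integrable_const _), integral_const, integral_const] at h2
  have hvol : (leb a b).real univ = b - a := by
    rw [measureReal_restrict_apply_univ, Real.volume_real_Ioo_of_le hab.out.le]
  rw [hvol, smul_eq_mul, smul_eq_mul] at h2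
  have h3 : ∫ t, ‖N.val t‖ ∂(leb a b) ≤ √(b - a) * ‖N‖ := by
    refine (integral_norm_le_sqrt hab.out.le N.memLp_val).trans ?_
    gcongr
    exact N.norm_fst_le
  have h4 : (b - a) * ‖N.rep x‖ ≤ (b - a) * (((b - a)⁻¹ * √(b - a) + √(b - a)) * ‖N‖) := by
    have e : (b - a) * (((b - a)⁻¹ * √(b - a) + √(b - a)) * ‖N‖)
      = √(b - a) * ‖N‖ + (b - a) * (√(b - a) * ‖N‖) := by field_simp
    rw [e]; linarith
  exact le_of_mul_le_mul_left h4 hlt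

/-- Evaluation at a point of `[a, b]`, as a continuous linear map on `H¹`. -/
def ev (x : ℝ) (hx : x ∈ Icc a b) : H1 a b →L[ℝ] E3 :=
  LinearMap.mkContinuousOfExistsBound
    { toFun := fun N => N.rep x
      map_add' := fun N M => rep_add N M hx
      map_smul' := fun c N => rep_smul c N hx }
    (by
      obtain ⟨K, _, hK⟩ := exists_norm_rep_le a b
      exact ⟨K, fun N => hK N x hx⟩)

omit hab in
theorem isClosed_H1Space : IsClosed
    (H1Space a b : Set (WithLp 2 (Lp E3 2 (leb a b) × Lp E3 2 (leb a b)))) := by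
  have key : ∀ {φ : ℝ → ℝ}, Continuous φ → HasCompactSupport φ →
      Continuous fun f : Lp E3 2 (leb a b) => ∫ x, φ x • f x ∂(leb a b) := by
    intro φ hc hs
    have hm : MemLp φ 2 (leb a b) := (hc.memLp_of_hasCompactSupport hs).restrict _
    have e : (fun f : Lp E3 2 (leb a b) => ∫ x, φ x • f x ∂(leb a b)) =
        fun f => (ContinuousLinearMap.lsmul ℝ ℝ).lpPairing (leb a b) 2 2 (hm.toLp φ) f := by
      funext f
      rw [ContinuousLinearMap.lpPairing_eq_integral]
      refine integral_congr_ae ?_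
      filter_upwards [hm.coeFn_toLp] with x hx
      rw [hx]; rfl
    rw [e]
    exact ContinuousLinearMap.continuous _
  have : (H1Space a b : Set (WithLp 2 (Lp E3 2 (leb a b) × Lp E3 2 (leb a b)))) =
      ⋂ (φ : ℝ → ℝ) (_ : ContDiff ℝ (⊤ : ℕ∞) φ) (_ : HasCompactSupport φ)
        (_ : tsupport φ ⊆ Ioo a b), {p | ∫ x, deriv φ x • p.fst x ∂(leb a b)
          = - ∫ x, φ x • p.snd x ∂(leb a b)} := by
    ext p
    simp only [mem_iInter]
    rfl
  rw [this]
  refine isClosed_iInter fun φ => isClosed_iInter fun h1 => isClosed_iInter fun h2 =>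
    isClosed_iInter fun _ => isClosed_eq ?_ ?_
  · exact (key (h1.continuous_deriv (by simp)) h2.deriv).comp (WithLp.fstL 2 ℝ _ _).continuous
  · exact ((key h1.continuous h2).comp (WithLp.sndL 2 ℝ _ _).continuous).neg

instance : CompleteSpace (H1 a b) := isClosed_H1Space.completeSpace_coe

end H1

/-! ### Cross product and matrix action -/

theorem inner_E3 (x y : E3) : inner ℝ x y = x 0 * y 0 + x 1 * y 1 + x 2 * y 2 := by
  simp [PiLp.inner_apply, Fin.sum_univ_three]; ring

@[simp] theorem wedge_apply_zero (x y : E3) : wedge x y 0 = x 1 * y 2 - x 2 * y 1 := by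
  simp [wedge, cross_apply]

@[simp] theorem wedge_apply_one (x y : E3) : wedge x y 1 = x 2 * y 0 - x 0 * y 2 := by
  simp [wedge, cross_apply]

@[simp] theorem wedge_apply_two (x y : E3) : wedge x y 2 = x 0 * y 1 - x 1 * y 0 := by
  simp [wedge, cross_apply]

theorem E3_ext {x y : E3} (h0 : x 0 = y 0) (h1 : x 1 = y 1) (h2 : x 2 = y 2) : x = y := by
  ext i; fin_cases i <;> assumption

/-- The wedge product as a continuous bilinear map. -/
def wedgeL : E3 →L[ℝ] E3 →L[ℝ] E3 :=
  LinearMap.toContinuousLinearMap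
    ((LinearMap.toContinuousLinearMap : (E3 →ₗ[ℝ] E3) ≃ₗ[ℝ] (E3 →L[ℝ] E3)).toLinearMap ∘ₗ
      LinearMap.mk₂ ℝ wedge
        (fun x y z => by apply E3_ext <;> simp <;> ring)
        (fun c x y => by apply E3_ext <;> simp <;> ring)
        (fun x y z => by apply E3_ext <;> simp <;> ring)
        (fun c x y => by apply E3_ext <;> simp <;> ring))

@[simp] theorem wedgeL_apply (x y : E3) : wedgeL x y = wedge x y := rfl

/-- The action of matrices on vectors as a continuous bilinear map. -/
def actL : Mat3 →L[ℝ] E3 →L[ℝ] E3 :=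
  LinearMap.toContinuousLinearMap
    ((LinearMap.toContinuousLinearMap : (E3 →ₗ[ℝ] E3) ≃ₗ[ℝ] (E3 →L[ℝ] E3)).toLinearMap ∘ₗ
      LinearMap.mk₂ ℝ act
        (fun x y z => by simp [act, Matrix.add_mulVec])
        (fun c x y => by simp [act, Matrix.smul_mulVec])
        (fun x y z => by simp [act, Matrix.mulVec_add])
        (fun c x y => by simp [act, Matrix.mulVec_smul]))

@[simp] theorem actL_apply (A : Mat3) (x : E3) : actL A x = act A x := rfl

theorem act_mul (A B : Mat3) (x : E3) : act (A * B) x = act A (act B x) := by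
  simp [act, Matrix.mulVec_mulVec]

theorem act_one (x : E3) : act 1 x = x := by simp [act]

theorem act_neg (A : Mat3) (x : E3) : act A (-x) = - act A x := (actL A).map_neg x

theorem act_S_zero : act S (e 0) = - e 1 := by
  ext i; fin_cases i <;> simp [act, e, S]

theorem act_S_one : act S (e 1) = e 0 := by
  ext i; fin_cases i <;> simp [act, e, S]

@[simp] theorem inner_self_wedge (x y : E3) : inner ℝ x (wedge y x) = 0 := by
  simp only [inner_E3, wedge_apply_zero, wedge_apply_one, wedge_apply_two]; ring

@[simp] theorem wedge_self (x : E3) : wedge x x = 0 := by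
  apply E3_ext <;> simp <;> ring

theorem wedge_smul_left (c : ℝ) (x y : E3) : wedge (c • x) y = c • wedge x y := by
  rw [← wedgeL_apply, map_smul]; rfl

theorem wedge_add_left (x y z : E3) : wedge (x + y) z = wedge x z + wedge y z := by
  rw [← wedgeL_apply, map_add]; rfl

namespace H1

variable {a b : ℝ} [hab : Fact (a < b)]

/-! ### Pointwise products as bounded operators on `H¹` -/

theorem tendsto_rep {ι : Type*} {l : Filter ι} {N : ι → H1 a b} {M : H1 a b}
    (h : Tendsto N l (𝓝 M)) {x : ℝ} (hx : x ∈ Icc a b) :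
    Tendsto (fun n => (N n).rep x) l (𝓝 (M.rep x)) :=
  ((ev x hx).continuous.tendsto M).comp h

omit hab in
theorem memLp_bilin_der {V W Z : Type*} [NormedAddCommGroup V] [NormedSpace ℝ V]
    [NormedAddCommGroup W] [NormedSpace ℝ W] [NormedAddCommGroup Z] [NormedSpace ℝ Z]
    {f g : ℝ → V} {f' g' : ℝ → W} (hf : HasACDeriv a b f g) (hg : MemLp g 2 (leb a b))
    (hf' : HasACDeriv a b f' g') (hg' : MemLp g' 2 (leb a b)) (B : V →L[ℝ] W →L[ℝ] Z) :
    MemLp (fun x => B (f x) (g' x) + B (g x) (f' x)) 2 (leb a b) :=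
  (B.memLp_of_bilin (p := ∞) (q := 2) 2 (hf.memLp ∞) hg').add
    (B.memLp_of_bilin (p := 2) (q := ∞) 2 hg (hf'.memLp ∞))

omit hab in
theorem hasACDeriv_id : HasACDeriv a b (fun x : ℝ => x) (deriv fun x : ℝ => x) :=
  HasACDeriv.of_contDiff contDiff_id

omit hab in
theorem memLp_deriv_id : MemLp (deriv fun x : ℝ => x) 2 (leb a b) := by
  rw [deriv_id'']; exact memLp_const 1

/-- The product of an element of `H¹` with the coordinate `ω`. -/
def mulXFun (N : H1 a b) : H1 a b :=
  ofAC _ _ (hasACDeriv_id.bilin N.rep_ac (ContinuousLinearMap.lsmul ℝ ℝ))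
    (memLp_bilin_der hasACDeriv_id memLp_deriv_id N.rep_ac N.memLp_der
      (ContinuousLinearMap.lsmul ℝ ℝ))

theorem rep_mulXFun (N : H1 a b) {x : ℝ} (hx : x ∈ Icc a b) :
    (mulXFun N).rep x = x • N.rep x :=
  rep_ofAC _ _ hx

/-- Multiplication by the coordinate `ω`, on `H¹`. It is continuous by the closed graph theorem,
products being determined by their values at points. -/
def mulX : H1 a b →L[ℝ] H1 a b :=
  ContinuousLinearMap.ofSeqClosedGraph (g :=
    ({ toFun := mulXFun
       map_add' := fun N M => ext_rep fun x hx => by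
        rw [rep_mulXFun _ hx, rep_add _ _ hx, rep_add _ _ hx, rep_mulXFun _ hx,
          rep_mulXFun _ hx, smul_add]
       map_smul' := fun c N => ext_rep fun x hx => by
        rw [rep_mulXFun _ hx, rep_smul _ _ hx, RingHom.id_apply, rep_smul _ _ hx,
          rep_mulXFun _ hx, smul_comm] } : H1 a b →ₗ[ℝ] H1 a b))
    (fun u N M hN hM => ext_rep fun x hx => tendsto_nhds_unique (tendsto_rep hM hx) (by
      have h := (tendsto_rep hN hx).const_smul x
      rw [← rep_mulXFun N hx] at h
      exact h.congr fun n => (rep_mulXFun (u n) hx).symm))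

theorem rep_mulX (N : H1 a b) {x : ℝ} (hx : x ∈ Icc a b) : (mulX N).rep x = x • N.rep x :=
  rep_mulXFun N hx

/-- The pointwise wedge product of two elements of `H¹`. -/
def wedgeFun (g N : H1 a b) : H1 a b :=
  ofAC _ _ (g.rep_ac.bilin N.rep_ac wedgeL)
    (memLp_bilin_der g.rep_ac g.memLp_der N.rep_ac N.memLp_der wedgeL)

theorem rep_wedgeFun (g N : H1 a b) {x : ℝ} (hx : x ∈ Icc a b) :
    (wedgeFun g N).rep x = wedge (g.rep x) (N.rep x) :=
  rep_ofAC _ _ hx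

/-- The operator `N ↦ g ∧ N` on `H¹`. -/
def wedgeOp (g : H1 a b) : H1 a b →L[ℝ] H1 a b :=
  ContinuousLinearMap.ofSeqClosedGraph (g :=
    { toFun := wedgeFun g
      map_add' := fun N M => ext_rep fun x hx => by
        simp only [rep_wedgeFun _ _ hx, rep_add _ _ hx, ← wedgeL_apply, map_add]
      map_smul' := fun c N => ext_rep fun x hx => by
        simp only [rep_wedgeFun _ _ hx, rep_smul _ _ hx, ← wedgeL_apply, map_smul,
          RingHom.id_apply] })
    (fun u N M hN hM => ext_rep fun x hx => tendsto_nhds_unique (tendsto_rep hM hx) (by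
      have h := ((wedgeL (g.rep x)).continuous.tendsto _).comp (tendsto_rep hN hx)
      rw [wedgeL_apply, ← rep_wedgeFun g N hx] at h
      exact h.congr fun n => (rep_wedgeFun g (u n) hx).symm))

theorem rep_wedgeOp (g N : H1 a b) {x : ℝ} (hx : x ∈ Icc a b) :
    (wedgeOp g N).rep x = wedge (g.rep x) (N.rep x) :=
  rep_wedgeFun g N hx

/-- A form of the closed graph theorem: a linear family of operators is continuous as soon as the
graph of each of its evaluations is closed. -/
theorem continuous_of_closed_graph_apply {V W Z : Type*} [NormedAddCommGroup V] [NormedSpace ℝ V]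
    [NormedAddCommGroup W] [NormedSpace ℝ W] [NormedAddCommGroup Z] [NormedSpace ℝ Z]
    [CompleteSpace V] [CompleteSpace Z] (A : V →ₗ[ℝ] W →L[ℝ] Z)
    (h : ∀ (N : W) (u : ℕ → V) (g : V) (z : Z), Tendsto u atTop (𝓝 g) →
      Tendsto (fun n => A (u n) N) atTop (𝓝 z) → z = A g N) : Continuous A :=
  A.continuous_of_seq_closed_graph fun u g _ hg hA => ContinuousLinearMap.ext fun N =>
    h N u g _ hg (((ContinuousLinearMap.apply ℝ Z N).continuous.tendsto _).comp hA)

/-- The pointwise wedge product as a linear family of operators on `H¹`. -/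
def wedgeLin : H1 a b →ₗ[ℝ] H1 a b →L[ℝ] H1 a b where
  toFun := wedgeOp
  map_add' g h := ContinuousLinearMap.ext fun N => ext_rep fun x hx => by
    rw [rep_wedgeOp _ _ hx, rep_add _ _ hx, add_apply, rep_add _ _ hx, rep_wedgeOp _ _ hx,
      rep_wedgeOp _ _ hx, wedge_add_left]
  map_smul' c g := ContinuousLinearMap.ext fun N => ext_rep fun x hx => by
    rw [rep_wedgeOp _ _ hx, rep_smul _ _ hx, RingHom.id_apply, smul_apply, rep_smul _ _ hx,
      rep_wedgeOp _ _ hx, wedge_smul_left]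

theorem continuous_wedgeLin : Continuous (wedgeLin (a := a) (b := b)) :=
  continuous_of_closed_graph_apply wedgeLin fun N u g z hg hz => ext_rep fun x hx => by
    have h2 := ((wedgeL.flip (N.rep x)).continuous.tendsto _).comp (tendsto_rep hg hx)
    rw [ContinuousLinearMap.flip_apply, wedgeL_apply, ← rep_wedgeOp g N hx] at h2
    exact tendsto_nhds_unique (tendsto_rep hz hx)
      (h2.congr fun n => (rep_wedgeOp (u n) N hx).symm)

/-- The pointwise wedge product as a continuous bilinear map on `H¹`. Continuity comes from the
closed graph theorem, products being determined by their values at points. -/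
def wedgeH1 : H1 a b →L[ℝ] H1 a b →L[ℝ] H1 a b := ⟨wedgeLin, continuous_wedgeLin⟩

theorem rep_wedgeH1 (g N : H1 a b) {x : ℝ} (hx : x ∈ Icc a b) :
    (wedgeH1 g N).rep x = wedge (g.rep x) (N.rep x) :=
  rep_wedgeFun g N hx

theorem der_wedgeH1 (g N : H1 a b) : (wedgeH1 g N).der =ᵐ[leb a b]
    fun x => wedge (g.rep x) (N.der x) + wedge (g.der x) (N.rep x) :=
  der_ofAC (g.rep_ac.bilin N.rep_ac wedgeL)
    (memLp_bilin_der g.rep_ac g.memLp_der N.rep_ac N.memLp_der wedgeL)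

/-- The integrand of `(W, N) ↦ ⟪N + e₃, W ∧ N⟫`, from values and derivatives of `W` and `N`. -/
def density (n' n w' w : E3) : ℝ := inner ℝ n' (wedge w' n) + inner ℝ (e 2) (wedge w n)

omit hab in
theorem integrable_bilin_of_L2 {V W Z : Type*} [NormedAddCommGroup V] [NormedSpace ℝ V]
    [NormedAddCommGroup W] [NormedSpace ℝ W] [NormedAddCommGroup Z] [NormedSpace ℝ Z]
    {f : ℝ → V} {g : ℝ → W}
    (hf : MemLp f 2 (leb a b)) (hg : MemLp g 2 (leb a b)) (B : V →L[ℝ] W →L[ℝ] Z) :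
    Integrable (fun x => B (f x) (g x)) (leb a b) :=
  memLp_one_iff_integrable.1 (B.memLp_of_bilin (p := 2) (q := 2) 1 hf hg)

theorem memLp_wedge_der (W N : H1 a b) :
    MemLp (fun x => wedge (W.der x) (N.rep x)) 2 (leb a b) :=
  wedgeL.memLp_of_bilin (p := 2) (q := ∞) 2 W.memLp_der (N.rep_ac.memLp ∞)

theorem integrable_density (N : H1 a b) {w w' : ℝ → E3} (hw : MemLp w 2 (leb a b))
    (hw' : MemLp w' 2 (leb a b)) :
    Integrable (fun x => density (N.der x) (N.rep x) (w' x) (w x)) (leb a b) := by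
  have h1 : MemLp (fun x => wedge (w' x) (N.rep x)) 2 (leb a b) :=
    wedgeL.memLp_of_bilin (p := 2) (q := ∞) 2 hw' (N.rep_ac.memLp ∞)
  have h2 : MemLp (fun x => wedge (w x) (N.rep x)) 2 (leb a b) :=
    wedgeL.memLp_of_bilin (p := 2) (q := ∞) 2 hw (N.rep_ac.memLp ∞)
  exact (integrable_bilin_of_L2 N.memLp_der h1 (innerSL ℝ)).add
    (integrable_bilin_of_L2 (memLp_const (e 2)) h2 (innerSL ℝ))

/-- The feedback functional is the scalar product in `H¹` of `N + e₃` with `W ∧ N`: the terms in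
which `N` meets `W ∧ N`, or `N'` meets `W ∧ N'`, vanish. -/
theorem inner_wedgeH1 (N W : H1 a b) :
    inner ℝ (N + H1.const a b (e 2)) (wedgeH1 W N)
      = ∫ x, density (N.der x) (N.rep x) (W.der x) (W.rep x) ∂(leb a b) := by
  have h2 : MemLp (fun x => wedge (W.rep x) (N.rep x)) 2 (leb a b) :=
    (W.rep_ac.bilin N.rep_ac wedgeL).memLp 2
  have i1 := integrable_bilin_of_L2 N.memLp_der (memLp_wedge_der W N) (innerSL ℝ)
  have i2 := integrable_bilin_of_L2 (memLp_const (e 2)) h2 (innerSL ℝ)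
  rw [inner_eq]
  unfold density
  have hsplit := integral_add i1 i2
  refine Eq.trans ?_ hsplit.symm
  rw [add_comm]
  congr 1
  · refine integral_congr_ae ?_
    filter_upwards [der_wedgeH1 W N, der_const (a := a) (b := b) (e 2),
      Lp.coeFn_add N.1.snd (H1.const a b (e 2)).1.snd] with x h1 h2 h3
    have h4 : (N + H1.const a b (e 2)).der x = N.der x + (H1.const a b (e 2)).der x := h3
    rw [h1, h4, h2, add_zero, inner_add_right, inner_self_wedge, zero_add]
    rfl
  · refine integral_congr_ae ?_
    filter_upwards [(wedgeH1 W N).rep_ae, (N + H1.const a b (e 2)).rep_ae, ae_leb_mem a b]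
      with x h1 h2 hx
    have hx' := Ioo_subset_Icc_self hx
    rw [← h1, ← h2, rep_wedgeH1 _ _ hx', rep_add _ _ hx', rep_const _ hx', inner_add_left,
      inner_self_wedge, zero_add]
    rfl

/-! ### The rotating frame in `H¹` -/

section Rotation

variable {V : Type*} [NormedAddCommGroup V] [NormedSpace ℝ V]

/-- The generator `(g₁, g₂) ↦ (-X g₂, X g₁)` of the rotation of the frame. -/
def rotGen (X : V →L[ℝ] V) : (V × V) →L[ℝ] (V × V) :=
  (-(X.comp (ContinuousLinearMap.snd ℝ V V))).prod (X.comp (ContinuousLinearMap.fst ℝ V V))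

/-- The rotation group with generator `rotGen X`, applied to the pair `r`. -/
def rotPair (X : V →L[ℝ] V) (r : V × V) (s : ℝ) : V × V := NormedSpace.exp (s • rotGen X) r

theorem rotPair_zero (X : V →L[ℝ] V) (r : V × V) : rotPair X r 0 = r := by
  simp [rotPair]

theorem hasDerivAt_rotPair [CompleteSpace V] (X : V →L[ℝ] V) (r : V × V) (s : ℝ) :
    HasDerivAt (rotPair X r) (-X (rotPair X r s).2, X (rotPair X r s).1) s :=
  (ContinuousLinearMap.apply ℝ (V × V) r).hasFDerivAt.comp_hasDerivAt s
    (hasDerivAt_exp_smul_const' (𝕂 := ℝ) (rotGen X) s)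

end Rotation

/-- The pair `(F e₁, F e₂)` at `σ = s`, when `r` is the pair of the first two columns of `R`. -/
def rot (r : H1 a b × H1 a b) (s : ℝ) : H1 a b × H1 a b := rotPair mulX r s

theorem rot_zero (r : H1 a b × H1 a b) : rot r 0 = r := rotPair_zero _ _

theorem hasDerivAt_rot (r : H1 a b × H1 a b) (s : ℝ) :
    HasDerivAt (rot r) (-mulX (rot r s).2, mulX (rot r s).1) s :=
  hasDerivAt_rotPair mulX r s

/-- The column `F eᵢ` at `σ = s`. -/
def col (r : H1 a b × H1 a b) (i : Fin 2) (s : ℝ) : H1 a b :=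
  if i = 0 then (rot r s).1 else (rot r s).2

theorem continuous_col (r : H1 a b × H1 a b) (i : Fin 2) : Continuous (col r i) := by
  have h : Continuous (rot r) :=
    continuous_iff_continuousAt.2 fun s => (hasDerivAt_rot r s).continuousAt
  unfold col
  split_ifs
  · exact continuous_fst.comp h
  · exact continuous_snd.comp h

theorem rep_neg (N : H1 a b) {x : ℝ} (hx : x ∈ Icc a b) : (-N).rep x = -N.rep x :=
  (ev x hx).map_neg N

theorem hasDerivAt_rep_rot (r : H1 a b × H1 a b) (s : ℝ) {x : ℝ} (hx : x ∈ Icc a b) :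
    HasDerivAt (fun s => (rot r s).1.rep x) (-(x • (rot r s).2.rep x)) s ∧
    HasDerivAt (fun s => (rot r s).2.rep x) (x • (rot r s).1.rep x) s := by
  have h := hasDerivAt_rot r s
  have h1 := ((ev x hx).comp
    (ContinuousLinearMap.fst ℝ (H1 a b) (H1 a b))).hasFDerivAt.comp_hasDerivAt s h
  have h2 := ((ev x hx).comp
    (ContinuousLinearMap.snd ℝ (H1 a b) (H1 a b))).hasFDerivAt.comp_hasDerivAt s h
  refine ⟨h1.congr_deriv ?_, h2.congr_deriv (rep_mulX _ hx)⟩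
  exact (rep_neg _ hx).trans (congrArg _ (rep_mulX _ hx))

end H1

/-- Two solutions of the rotation equation `z₁' = -x z₂`, `z₂' = x z₁` with the same initial value
agree, since the equation preserves `‖z₁‖² + ‖z₂‖²`. -/
theorem eq_of_rotation {V : Type*} [NormedAddCommGroup V] [InnerProductSpace ℝ V] {x : ℝ}
    {z₁ z₂ w₁ w₂ : ℝ → V}
    (hz : ∀ s, HasDerivAt z₁ (-(x • z₂ s)) s ∧ HasDerivAt z₂ (x • z₁ s) s)
    (hw : ∀ s, HasDerivAt w₁ (-(x • w₂ s)) s ∧ HasDerivAt w₂ (x • w₁ s) s)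
    (h1 : z₁ 0 = w₁ 0) (h2 : z₂ 0 = w₂ 0) (s : ℝ) : z₁ s = w₁ s ∧ z₂ s = w₂ s := by
  have hd : ∀ s, HasDerivAt (fun s => ‖z₁ s - w₁ s‖ ^ 2 + ‖z₂ s - w₂ s‖ ^ 2) 0 s := by
    intro s
    refine ((((hz s).1.sub (hw s).1).norm_sq).add
      (((hz s).2.sub (hw s).2).norm_sq)).congr_deriv ?_
    simp only [Pi.sub_apply]
    rw [show -(x • z₂ s) - -(x • w₂ s) = -(x • (z₂ s - w₂ s)) by rw [smul_sub]; abel,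
      ← smul_sub, inner_neg_right, inner_smul_right, inner_smul_right,
      real_inner_comm (z₂ s - w₂ s)]
    ring
  have hc := is_const_of_deriv_eq_zero (fun s => (hd s).differentiableAt)
    (fun s => (hd s).deriv) s 0
  simp only [h1, h2, sub_self, norm_zero] at hc
  have p1 := sq_nonneg ‖z₁ s - w₁ s‖
  have p2 := sq_nonneg ‖z₂ s - w₂ s‖
  constructor
  · rw [← sub_eq_zero, ← norm_eq_zero]
    exact pow_eq_zero_iff two_ne_zero |>.1 (by linarith)
  · rw [← sub_eq_zero, ← norm_eq_zero]
    exact pow_eq_zero_iff two_ne_zero |>.1 (by linarith)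

theorem hasDerivAt_exp_smul_S (s x : ℝ) :
    HasDerivAt (fun s : ℝ => NormedSpace.exp ((s * x) • S))
      (NormedSpace.exp ((s * x) • S) * (x • S)) s := by
  have h := hasDerivAt_exp_smul_const (𝕂 := ℝ) (x • S) s
  simpa only [smul_smul] using h

variable {a b : ℝ} [hab : Fact (a < b)] {Mf : ℝ → E3} {R : ℝ → Mat3}

/-- The weak derivative of the frame. -/
def IsFrame.deriv {a b : ℝ} {Mf : ℝ → E3} {R : ℝ → Mat3} (hR : IsFrame a b Mf R) :
    ℝ → Mat3 :=
  hR.2.1.2.choose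

omit hab in
theorem IsFrame.memLp_deriv (hR : IsFrame a b Mf R) : MemLp hR.deriv 2 (leb a b) :=
  hR.2.1.2.choose_spec.1

theorem IsFrame.hasACDeriv (hR : IsFrame a b Mf R) : HasACDeriv a b R hR.deriv :=
  hR.2.1.2.choose_spec.2.hasACDeriv hab.out hR.1 (hR.memLp_deriv.integrable (by norm_num))

/-- A column of the frame, as an element of `H¹`. -/
def IsFrame.col (hR : IsFrame a b Mf R) (i : Fin 3) : H1 a b :=
  H1.ofAC _ _ (hR.hasACDeriv.clm (actL.flip (e i))) ((actL.flip (e i)).comp_memLp' hR.memLp_deriv)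

theorem IsFrame.rep_col (hR : IsFrame a b Mf R) (i : Fin 3) {x : ℝ} (hx : x ∈ Icc a b) :
    (hR.col i).rep x = act (R x) (e i) :=
  H1.rep_ofAC _ _ hx

/-- The first two columns of the frame. -/
def IsFrame.cols (hR : IsFrame a b Mf R) : H1 a b × H1 a b := (hR.col 0, hR.col 1)

/-- The rotation group of `H¹` acts pointwise on the first two columns as right multiplication of
`R(x)` by `exp(s x S)`: both pairs solve the same rotation equation in `s`. -/
theorem IsFrame.rep_rot (hR : IsFrame a b Mf R) (i : Fin 2) (s : ℝ) {x : ℝ} (hx : x ∈ Icc a b) :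
    (H1.col hR.cols i s).rep x = act (R x * NormedSpace.exp ((s * x) • S)) (e i.castSucc) := by
  have key := eq_of_rotation (x := x) (z₁ := fun s => (H1.rot hR.cols s).1.rep x)
    (z₂ := fun s => (H1.rot hR.cols s).2.rep x)
    (w₁ := fun s => act (R x * NormedSpace.exp ((s * x) • S)) (e 0))
    (w₂ := fun s => act (R x * NormedSpace.exp ((s * x) • S)) (e 1))
    (fun s => H1.hasDerivAt_rep_rot hR.cols s hx)
    (fun s => by
      have hd : ∀ v : E3, HasDerivAt (fun s => act (R x * NormedSpace.exp ((s * x) • S)) v)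
          (x • act (R x * NormedSpace.exp ((s * x) • S)) (act S v)) s := by
        intro v
        have h1 := (hasDerivAt_exp_smul_S s x).const_mul (R x)
        have h2 := (actL.flip v).hasFDerivAt.comp_hasDerivAt s h1
        refine h2.congr_deriv ?_
        rw [← act_mul, mul_smul_comm, mul_smul_comm, ← mul_assoc]
        exact (actL.flip v).map_smul x _
      refine ⟨?_, ?_⟩
      · simpa only [act_S_zero, act_neg, smul_neg] using hd (e 0)
      · simpa only [act_S_one] using hd (e 1))
    (by simp [H1.rot_zero, IsFrame.cols, hR.rep_col _ hx])
    (by simp [H1.rot_zero, IsFrame.cols, hR.rep_col _ hx]) s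
  fin_cases i
  · exact key.1
  · exact key.2

theorem contDiff_exp_smul_S (s : ℝ) :
    ContDiff ℝ 1 (fun x : ℝ => NormedSpace.exp ((s * x) • S)) := by
  have hd : ∀ x : ℝ, HasDerivAt (fun x : ℝ => NormedSpace.exp ((s * x) • S))
      (NormedSpace.exp ((s * x) • S) * (s • S)) x := fun x => by
    simpa only [mul_comm] using hasDerivAt_exp_smul_S x s
  refine contDiff_one_iff_deriv.2 ⟨fun x => (hd x).differentiableAt, ?_⟩
  have hc : Continuous (fun x : ℝ => NormedSpace.exp ((s * x) • S)) :=
    continuous_iff_continuousAt.2 fun x => (hd x).continuousAt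
  rw [funext fun x => (hd x).deriv]
  exact hc.mul continuous_const

/-- The field `F(t, ·)` has a weak derivative in `L²`. -/
theorem IsFrame.exists_weakDeriv_F (hR : IsFrame a b Mf R) (T t : ℝ) :
    ∃ g : ℝ → Mat3, MemLp g 2 (leb a b) ∧ IsWeakDeriv a b (F T R t) g := by
  have hE : HasACDeriv a b _ _ := HasACDeriv.of_contDiff (contDiff_exp_smul_S (sigma T t))
  have hE2 : MemLp (_root_.deriv fun x : ℝ => NormedSpace.exp ((sigma T t * x) • S)) 2
      (leb a b) := by
    have hc := (contDiff_exp_smul_S (sigma T t)).continuous_deriv le_rfl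
    obtain ⟨C, hC⟩ := isCompact_Icc.exists_bound_of_continuousOn (hc.continuousOn (s := Icc a b))
    refine MemLp.of_bound hc.aestronglyMeasurable C ?_
    filter_upwards [ae_leb_mem a b] with x hx using hC x (Ioo_subset_Icc_self hx)
  exact ⟨_, H1.memLp_bilin_der hR.hasACDeriv hR.memLp_deriv hE hE2 (ContinuousLinearMap.mul ℝ Mat3),
    (hR.hasACDeriv.bilin hE (ContinuousLinearMap.mul ℝ Mat3)).isWeakDeriv hab.out.le⟩

/-- The chosen weak derivative of `F(t, ·)` is, column by column, the derivative of the columns as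
elements of `H¹`. -/
theorem IsFrame.act_weakDeriv_F (hR : IsFrame a b Mf R) (T t : ℝ) (i : Fin 2) :
    (fun x => act (weakDeriv a b (F T R t) x) (e i.castSucc))
      =ᵐ[leb a b] (H1.col hR.cols i (sigma T t)).der := by
  have hex := hR.exists_weakDeriv_F T t
  have hspec : MemLp (weakDeriv a b (F T R t)) 2 (leb a b) ∧
      IsWeakDeriv a b (F T R t) (weakDeriv a b (F T R t)) := by
    rw [weakDeriv, dif_pos hex]; exact hex.choose_spec
  have hFi : Integrable (F T R t) (leb a b) := by
    have hE : HasACDeriv a b _ _ := HasACDeriv.of_contDiff (contDiff_exp_smul_S (sigma T t))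
    exact memLp_one_iff_integrable.1
      ((hR.hasACDeriv.bilin hE (ContinuousLinearMap.mul ℝ Mat3)).memLp 1)
  have hw := hspec.2.clm hFi (hspec.1.integrable (by norm_num)) (actL.flip (e i.castSucc))
  set g := H1.col hR.cols i (sigma T t) with hg
  refine IsWeakDeriv.ae_unique ?_ hw g.2
    (((actL.flip (e i.castSucc)).comp_memLp' hspec.1).integrable (by norm_num)) g.integrable_der
  filter_upwards [g.rep_ae, ae_leb_mem a b] with x hx hm
  change act (F T R t x) (e i.castSucc) = g.val x
  rw [← hx, hg, hR.rep_rot i _ (Ioo_subset_Icc_self hm)]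
  rfl

theorem IsFrame.act_F (hR : IsFrame a b Mf R) (T t : ℝ) (i : Fin 2) {x : ℝ} (hx : x ∈ Icc a b) :
    act (F T R t x) (e i.castSucc) = (H1.col hR.cols i (sigma T t)).rep x :=
  (hR.rep_rot i _ hx).symm

/-- The functional `H_i[t, N]` is the scalar product in `H¹` of `N + e₃` with `F(t) eᵢ ∧ N`. -/
theorem IsFrame.H_eq (hR : IsFrame a b Mf R) (T t : ℝ) (i : Fin 2) (N : H1 a b) :
    H a b T R i t N = inner ℝ (N + H1.const a b (e 2))
      (H1.wedgeH1 (H1.col hR.cols i (sigma T t)) N) := by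
  rw [H1.inner_wedgeH1]
  refine integral_congr_ae ?_
  filter_upwards [hR.act_weakDeriv_F T t i, N.rep_ae, ae_leb_mem a b] with x h1 h2 hm
  rw [h1, hR.act_F T t i (Ioo_subset_Icc_self hm), ← h2]
  rfl

/-! ### Dissipative evolution equations in a Hilbert space -/

section Evolution

open Metric
open scoped NNReal RealInnerProductSpace

variable {V : Type*} [NormedAddCommGroup V]

theorem ode_solution_unique_Ici [NormedSpace ℝ V] {G : ℝ → V → V} {K : ℝ≥0} {s : Set V}
    (hK : ∀ t, LipschitzOnWith K (G t) s) {τ : ℝ} {y z : ℝ → V} {I J : Set ℝ}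
    (hI : ∀ t ∈ Ico 0 τ, I ∈ 𝓝[≥] t) (hJ : ∀ t ∈ Ico 0 τ, J ∈ 𝓝[≥] t)
    (hyc : ContinuousOn y (Icc 0 τ)) (hzc : ContinuousOn z (Icc 0 τ))
    (hy : ∀ t ∈ Ico 0 τ, HasDerivWithinAt y (G t (y t)) I t)
    (hz : ∀ t ∈ Ico 0 τ, HasDerivWithinAt z (G t (z t)) J t)
    (hys : ∀ t ∈ Ico 0 τ, y t ∈ s) (hzs : ∀ t ∈ Ico 0 τ, z t ∈ s)
    (h0 : y 0 = z 0) : EqOn y z (Icc 0 τ) :=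
  ODE_solution_unique_of_mem_Icc_right (s := fun _ => s) (fun t _ => hK t) hyc
    (fun t ht => (hy t ht).mono_of_mem_nhdsWithin (hI t ht)) hys hzc
    (fun t ht => (hz t ht).mono_of_mem_nhdsWithin (hJ t ht)) hzs h0

/-- A bounded, globally Lipschitz vector field has solutions defined for all positive times: the
Picard–Lindelöf solutions on the intervals `[0, n]` agree where they overlap. -/
theorem exists_global_of_lipschitz [NormedSpace ℝ V] [CompleteSpace V] {G : ℝ → V → V}
    {K L : ℝ≥0} (hc : ∀ y, Continuous (G · y)) (hK : ∀ t, LipschitzWith K (G t))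
    (hL : ∀ t y, ‖G t y‖ ≤ L) (y₀ : V) :
    ∃ y : ℝ → V, y 0 = y₀ ∧ ∀ t, 0 ≤ t → HasDerivWithinAt y (G t (y t)) (Ici 0) t := by
  have hex : ∀ n : ℕ, ∃ α : ℝ → V, α 0 = y₀ ∧
      ∀ t ∈ Icc (0 : ℝ) n, HasDerivWithinAt α (G t (α t)) (Icc (0 : ℝ) n) t := by
    intro n
    have hp : IsPicardLindelof G (tmin := 0) (tmax := n) ⟨0, le_rfl, Nat.cast_nonneg n⟩ y₀
        (L * n) 0 L K :=
      ⟨fun t _ => (hK t).lipschitzOnWith, fun y _ => (hc y).continuousOn, fun t _ y _ => hL t y,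
        by simp⟩
    exact hp.exists_eq_forall_mem_Icc_hasDerivWithinAt₀
  choose α h0 hα using hex
  have hnhds : ∀ {n : ℕ} {t : ℝ}, t ∈ Ico (0 : ℝ) n → Icc (0 : ℝ) n ∈ 𝓝[≥] t := fun ht =>
    mem_of_superset (Icc_mem_nhdsGE ht.2) (Icc_subset_Icc_left ht.1)
  have hagree : ∀ {m n : ℕ}, m ≤ n → EqOn (α m) (α n) (Icc (0 : ℝ) m) := by
    intro m n hmn
    have hmn' : (m : ℝ) ≤ n := Nat.cast_le.2 hmn
    have hsub : ∀ {t : ℝ}, t ∈ Icc (0 : ℝ) m → t ∈ Icc (0 : ℝ) n := fun ht =>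
      ⟨ht.1, ht.2.trans hmn'⟩
    refine ode_solution_unique_Ici (s := univ) (fun t => (hK t).lipschitzOnWith)
      (fun t ht => hnhds ht) (fun t ht => hnhds ⟨ht.1, ht.2.trans_le hmn'⟩)
      (fun t ht => (hα m t ht).continuousWithinAt)
      (fun t ht => (hα n t (hsub ht)).continuousWithinAt.mono fun x hx => hsub hx)
      (fun t ht => hα m t (Ico_subset_Icc_self ht))
      (fun t ht => hα n t (hsub (Ico_subset_Icc_self ht)))
      (fun _ _ => mem_univ _) (fun _ _ => mem_univ _) ((h0 m).trans (h0 n).symm)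
  have hfloor : ∀ {s : ℝ} {m : ℕ}, s ∈ Ico (0 : ℝ) m → α (⌊s⌋₊ + 1) s = α m s := by
    intro s m hs
    refine hagree ?_ ⟨hs.1, by push_cast; exact (Nat.lt_floor_add_one s).le⟩
    exact Nat.succ_le_of_lt ((Nat.floor_lt hs.1).2 hs.2)
  refine ⟨fun t => α (⌊t⌋₊ + 1) t, by simp [h0], fun t ht => ?_⟩
  set m : ℕ := ⌊t⌋₊ + 1 with hm
  have htm : t < m := by rw [hm]; push_cast; exact Nat.lt_floor_add_one t
  have hnb : Ico (0 : ℝ) m ∈ 𝓝[Ici 0] t := by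
    rw [← Ici_inter_Iio]
    exact inter_mem self_mem_nhdsWithin (mem_nhdsWithin_of_mem_nhds (Iio_mem_nhds htm))
  have hd : HasDerivWithinAt (α m) (G t (α m t)) (Ici 0) t :=
    (hα m t ⟨ht, htm.le⟩).mono_of_mem_nhdsWithin (mem_of_superset hnb Ico_subset_Icc_self)
  refine hd.congr_of_eventuallyEq ?_ rfl
  filter_upwards [hnb] with s hs using hfloor hs

section Radial

variable [NormedSpace ℝ V]

/-- The radial retraction on the ball of radius `r`. -/
def radial (r : ℝ) (y : V) : V := (r / max r ‖y‖) • y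

theorem norm_radial_le {r : ℝ} (hr : 0 < r) (y : V) : ‖radial r y‖ ≤ r := by
  have hm : 0 < max r ‖y‖ := lt_max_of_lt_left hr
  rw [radial, norm_smul, norm_div, Real.norm_of_nonneg hr.le, Real.norm_of_nonneg hm.le,
    div_mul_eq_mul_div, div_le_iff₀ hm]
  gcongr
  exact le_max_right _ _

theorem radial_of_norm_le {r : ℝ} (hr : 0 < r) {y : V} (hy : ‖y‖ ≤ r) : radial r y = y := by
  rw [radial, max_eq_left hy, div_self hr.ne', one_smul]

theorem lipschitzWith_radial {r : ℝ} (hr : 0 < r) : LipschitzWith 2 (radial r : V → V) := by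
  refine LipschitzWith.of_dist_le_mul fun x y => ?_
  rw [dist_eq_norm, dist_eq_norm]
  set p := max r ‖x‖ with hp
  set q := max r ‖y‖ with hq
  have p0 : 0 < p := lt_max_of_lt_left hr
  have q0 : 0 < q := lt_max_of_lt_left hr
  have e : radial r x - radial r y = (r / p) • (x - y) + (r / p - r / q) • y := by
    simp only [radial, ← hp, ← hq]; rw [smul_sub, sub_smul]; abel
  have e2 : r / p - r / q = (r / p) * ((q - p) / q) := by field_simp
  have hrp : r / p ≤ 1 := (div_le_one p0).2 (le_max_left _ _)
  have hrp0 : 0 ≤ r / p := by positivity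
  have hqp : |q - p| ≤ ‖x - y‖ := by
    rw [abs_sub_comm, hp, hq, max_comm r, max_comm r]
    exact (abs_max_sub_max_le_abs _ _ _).trans (abs_norm_sub_norm_le x y)
  have hyq : ‖y‖ / q ≤ 1 := (div_le_one q0).2 (le_max_right _ _)
  have h1 : ‖(r / p) • (x - y)‖ ≤ ‖x - y‖ := by
    rw [norm_smul, Real.norm_of_nonneg hrp0]
    exact mul_le_of_le_one_left (norm_nonneg _) hrp
  have h2 : ‖(r / p - r / q) • y‖ ≤ ‖x - y‖ := by
    rw [norm_smul, e2, norm_mul, Real.norm_of_nonneg hrp0, norm_div, Real.norm_of_nonneg q0.le,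
      Real.norm_eq_abs]
    calc r / p * (|q - p| / q) * ‖y‖ = r / p * (|q - p| * (‖y‖ / q)) := by ring
      _ ≤ 1 * (‖x - y‖ * 1) := by gcongr
      _ = ‖x - y‖ := by ring
  rw [e, NNReal.coe_ofNat, two_mul]
  exact (norm_add_le _ _).trans (add_le_add h1 h2)

end Radial

variable [InnerProductSpace ℝ V]

theorem hasDerivWithinAt_norm_sq {y : ℝ → V} {v : V} {s : Set ℝ} {t : ℝ}
    (h : HasDerivWithinAt y v s t) : HasDerivWithinAt (fun t => ‖y t‖ ^ 2) (2 * ⟪y t, v⟫) s t :=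
  h.norm_sq

theorem antitoneOn_of_hasDerivWithinAt_nonpos {f f' : ℝ → ℝ} {s : ℝ}
    (h : ∀ t, s ≤ t → HasDerivWithinAt f (f' t) (Ici s) t) (hn : ∀ t, s ≤ t → f' t ≤ 0) :
    AntitoneOn f (Ici s) := by
  have hd : ∀ t, s < t → HasDerivAt f (f' t) t := fun t ht =>
    (h t ht.le).hasDerivAt (Ici_mem_nhds ht)
  refine antitoneOn_of_deriv_nonpos (convex_Ici s) (fun t ht => (h t ht).continuousWithinAt) ?_ ?_
  · rw [interior_Ici]
    exact fun t ht => (hd t ht).differentiableAt.differentiableWithinAt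
  · rw [interior_Ici]
    intro t ht
    rw [(hd t ht).deriv]
    exact hn t (le_of_lt ht)

theorem norm_antitoneOn {y v : ℝ → V}
    (h : ∀ t, 0 ≤ t → HasDerivWithinAt y (v t) (Ici 0) t) (hn : ∀ t, 0 ≤ t → ⟪y t, v t⟫ ≤ 0) :
    AntitoneOn (fun t => ‖y t‖) (Ici 0) := by
  have := antitoneOn_of_hasDerivWithinAt_nonpos (fun t ht => hasDerivWithinAt_norm_sq (h t ht))
    (fun t ht => by have := hn t ht; linarith)
  exact fun s hs t ht hst => le_of_sq_le_sq (this hs ht hst) (norm_nonneg _)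

/-- A vector field that is Lipschitz on balls, vanishes at `0` and does not increase the norm has
global solutions. Truncating it radially gives a globally Lipschitz field that still does not
increase the norm, so that its solutions do not see the truncation. -/
theorem exists_global_of_dissipative [CompleteSpace V] {G : ℝ → V → V}
    (hc : ∀ y, Continuous (G · y))
    (hK : ∀ r : ℝ, ∃ K : ℝ≥0, ∀ t, LipschitzOnWith K (G t) (closedBall 0 r))
    (h0 : ∀ t, G t 0 = 0) (hn : ∀ t y, ⟪y, G t y⟫ ≤ 0) (y₀ : V) :
    ∃ y : ℝ → V, y 0 = y₀ ∧ ∀ t, 0 ≤ t → HasDerivWithinAt y (G t (y t)) (Ici 0) t := by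
  set r : ℝ := ‖y₀‖ + 1 with hr
  have r0 : 0 < r := by positivity
  obtain ⟨K, hK⟩ := hK r
  have hmem : ∀ y : V, radial r y ∈ closedBall (0 : V) r := fun y =>
    mem_closedBall_zero_iff.2 (norm_radial_le r0 y)
  obtain ⟨y, hy0, hy⟩ := exists_global_of_lipschitz (G := fun t y => G t (radial r y))
    (K := K * 2) (L := K * r.toNNReal) (fun y => hc _)
    (fun t => by
      rw [← lipschitzOnWith_univ]
      exact (hK t).comp (lipschitzWith_radial r0).lipschitzOnWith fun y _ => hmem y)
    (fun t y => by
      have := (hK t).dist_le_mul _ (hmem y) 0 (mem_closedBall_self r0.le)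
      rw [h0, dist_zero_right, dist_zero_right] at this
      refine this.trans ?_
      rw [NNReal.coe_mul, Real.coe_toNNReal r r0.le]
      gcongr
      exact norm_radial_le r0 y) y₀
  have hin : ∀ t, 0 ≤ t → ⟪y t, G t (radial r (y t))⟫ ≤ 0 := by
    intro t _
    have hm : 0 < max r ‖y t‖ := lt_max_of_lt_left r0
    have e : y t = (max r ‖y t‖ / r) • radial r (y t) := by
      rw [radial, smul_smul, div_mul_div_cancel₀ r0.ne', div_self hm.ne', one_smul]
    have e2 : ⟪y t, G t (radial r (y t))⟫
        = (max r ‖y t‖ / r) * ⟪radial r (y t), G t (radial r (y t))⟫ := by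
      rw [← real_inner_smul_left, ← e]
    rw [e2]
    exact mul_nonpos_of_nonneg_of_nonpos (by positivity) (hn _ _)
  have hanti := norm_antitoneOn hy hin
  refine ⟨y, hy0, fun t ht => ?_⟩
  have hle : ‖y t‖ ≤ r := by
    have := hanti (mem_Ici.2 le_rfl) (mem_Ici.2 ht) ht
    simp only [hy0] at this
    linarith
  have := hy t ht
  rwa [radial_of_norm_le r0 hle] at this

/-- Solutions stay in the ball of radius `‖y 0‖`, where the field is Lipschitz. -/
theorem unique_of_dissipative {G : ℝ → V → V}
    (hK : ∀ r : ℝ, ∃ K : ℝ≥0, ∀ t, LipschitzOnWith K (G t) (closedBall 0 r))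
    (hn : ∀ t y, ⟪y, G t y⟫ ≤ 0) {y z : ℝ → V}
    (hy : ∀ t, 0 ≤ t → HasDerivWithinAt y (G t (y t)) (Ici 0) t)
    (hz : ∀ t, 0 ≤ t → HasDerivWithinAt z (G t (z t)) (Ici 0) t) (h0 : y 0 = z 0) :
    ∀ t, 0 ≤ t → y t = z t := by
  intro t ht
  obtain ⟨K, hK⟩ := hK ‖y 0‖
  have hnb : ∀ s ∈ Ico 0 t, Ici (0 : ℝ) ∈ 𝓝[≥] s := fun s hs =>
    mem_of_superset self_mem_nhdsWithin (Ici_subset_Ici.2 hs.1)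
  have hcont : ∀ {w : ℝ → V}, (∀ t, 0 ≤ t → HasDerivWithinAt w (G t (w t)) (Ici 0) t) →
      ContinuousOn w (Icc 0 t) := fun hw s hs =>
    (hw s hs.1).continuousWithinAt.mono Icc_subset_Ici_self
  have hb : ∀ {w : ℝ → V}, (∀ t, 0 ≤ t → HasDerivWithinAt w (G t (w t)) (Ici 0) t) →
      w 0 = y 0 → ∀ s ∈ Ico 0 t, w s ∈ closedBall (0 : V) ‖y 0‖ := fun hw he s hs => by
    rw [mem_closedBall_zero_iff, ← he]
    exact norm_antitoneOn hw (fun s _ => hn s _) (mem_Ici.2 le_rfl) (mem_Ici.2 hs.1) hs.1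
  exact ode_solution_unique_Ici hK hnb hnb (hcont hy) (hcont hz) (fun s hs => hy s hs.1)
    (fun s hs => hz s hs.1) (hb hy rfl) (hb hz h0.symm) h0 ⟨ht, le_rfl⟩

/-! ### The feedback field -/

section Feedback

variable {ι : Type*} [Fintype ι]

/-- The output `⟪y, A (y - E)⟫`. -/
def output (A : V →L[ℝ] V) (E y : V) : ℝ := ⟪y, A (y - E)⟫

/-- The closed-loop vector field, in the variable `y = N + E`. -/
def feedback (A : ι → ℝ → V →L[ℝ] V) (E : V) (t : ℝ) (y : V) : V :=
  -∑ i, output (A i t) E y • A i t (y - E)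

theorem inner_feedback (A : ι → ℝ → V →L[ℝ] V) (E : V) (t : ℝ) (y : V) :
    ⟪y, feedback A E t y⟫ = -∑ i, output (A i t) E y ^ 2 := by
  simp only [feedback, inner_neg_right, inner_sum, inner_smul_right, output, sq]

theorem inner_feedback_nonpos (A : ι → ℝ → V →L[ℝ] V) (E : V) (t : ℝ) (y : V) :
    ⟪y, feedback A E t y⟫ ≤ 0 := by
  rw [inner_feedback, neg_nonpos]
  exact Finset.sum_nonneg fun i _ => sq_nonneg _

theorem feedback_zero (A : ι → ℝ → V →L[ℝ] V) (E : V) (t : ℝ) : feedback A E t 0 = 0 := by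
  simp [feedback, output]

theorem continuous_feedback {A : ι → ℝ → V →L[ℝ] V} (hA : ∀ i, Continuous (A i)) (E y : V) :
    Continuous (feedback A E · y) := by
  unfold feedback output
  refine (continuous_finsetSum _ fun i _ => ?_).neg
  have h : Continuous fun t => A i t (y - E) := (hA i).clm_apply continuous_const
  exact (continuous_const.inner h).smul h

theorem norm_apply_le {A : V →L[ℝ] V} {E y : V} {β r : ℝ} (hA : ‖A‖ ≤ β) (hy : ‖y‖ ≤ r) :
    ‖A (y - E)‖ ≤ β * (r + ‖E‖) := by
  have hr : 0 ≤ r := (norm_nonneg _).trans hy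
  exact (A.le_opNorm _).trans (mul_le_mul hA ((norm_sub_le _ _).trans (by gcongr))
    (norm_nonneg _) ((norm_nonneg _).trans hA))

theorem abs_output_le {A : V →L[ℝ] V} {E y : V} {β r : ℝ} (hA : ‖A‖ ≤ β) (hy : ‖y‖ ≤ r) :
    |output A E y| ≤ r * (β * (r + ‖E‖)) :=
  (abs_real_inner_le_norm _ _).trans (mul_le_mul hy (norm_apply_le hA hy) (norm_nonneg _)
    ((norm_nonneg _).trans hy))

/-- The output depends continuously on the operator and on the state. -/
theorem abs_output_sub_le {A B : V →L[ℝ] V} {E y z : V} {β r : ℝ} (hA : ‖A‖ ≤ β)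
    (hy : ‖y‖ ≤ r) (hz : ‖z‖ ≤ r) :
    |output A E y - output B E z| ≤
      (β * (r + ‖E‖) + r * β) * ‖y - z‖ + r * (r + ‖E‖) * ‖A - B‖ := by
  have hr : 0 ≤ r := (norm_nonneg _).trans hy
  have hβ : 0 ≤ β := (norm_nonneg _).trans hA
  have e : output A E y - output B E z
      = ⟪y - z, A (y - E)⟫ + ⟪z, A (y - z)⟫ + ⟪z, (A - B) (z - E)⟫ := by
    simp only [output, inner_sub_left, inner_sub_right, map_sub, sub_apply]
    ring
  have h1 : |⟪y - z, A (y - E)⟫| ≤ ‖y - z‖ * (β * (r + ‖E‖)) :=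
    (abs_real_inner_le_norm _ _).trans
      (mul_le_mul_of_nonneg_left (norm_apply_le hA hy) (norm_nonneg _))
  have h2 : |⟪z, A (y - z)⟫| ≤ r * (β * ‖y - z‖) :=
    (abs_real_inner_le_norm _ _).trans (mul_le_mul hz ((A.le_opNorm _).trans (by gcongr))
      (norm_nonneg _) hr)
  have h3 : |⟪z, (A - B) (z - E)⟫| ≤ r * (‖A - B‖ * (r + ‖E‖)) :=
    (abs_real_inner_le_norm _ _).trans (mul_le_mul hz (norm_apply_le le_rfl hz)
      (norm_nonneg _) hr)
  rw [e]
  refine (abs_add_three _ _ _).trans ?_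
  linarith

theorem lipschitzOnWith_feedback {A : ι → ℝ → V →L[ℝ] V} {β : ℝ} (hA : ∀ i t, ‖A i t‖ ≤ β)
    (E : V) (r : ℝ) :
    ∃ K : ℝ≥0, ∀ t, LipschitzOnWith K (feedback A E t) (closedBall 0 r) := by
  rcases lt_or_ge r 0 with hr | hr
  · exact ⟨0, fun t => by rw [closedBall_eq_empty.2 hr]; simp [LipschitzOnWith]⟩
  -- The bound `β` can be negative only if there are no operators at all.
  by_cases hβ : 0 ≤ β
  swap
  · refine ⟨0, fun t => ?_⟩
    have : IsEmpty ι := ⟨fun i => hβ ((norm_nonneg _).trans (hA i 0))⟩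
    exact LipschitzOnWith.of_dist_le_mul fun x _ y _ => by simp [feedback]
  set M := β * (r + ‖E‖) with hM
  have M0 : 0 ≤ M := by positivity
  refine ⟨⟨Fintype.card ι * ((M + r * β) * M + r * M * β), by positivity⟩, fun t =>
    LipschitzOnWith.of_dist_le_mul fun y hy z hz => ?_⟩
  rw [mem_closedBall_zero_iff] at hy hz
  rw [dist_eq_norm, dist_eq_norm]
  have e : feedback A E t y - feedback A E t z = -∑ i,
      ((output (A i t) E y - output (A i t) E z) • A i t (y - E)
        + output (A i t) E z • A i t (y - z)) := by
    rw [feedback, feedback, neg_sub_neg, ← Finset.sum_sub_distrib, ← Finset.sum_neg_distrib]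
    refine Finset.sum_congr rfl fun i _ => ?_
    rw [sub_smul, ← sub_sub_sub_cancel_right y z E, map_sub (A i t) (y - E), smul_sub]
    abel
  rw [e, norm_neg]
  refine (norm_sum_le _ _).trans ?_
  change _ ≤ Fintype.card ι * ((M + r * β) * M + r * M * β) * ‖y - z‖
  have hterm : ∀ i ∈ Finset.univ, ‖(output (A i t) E y - output (A i t) E z) • A i t (y - E)
        + output (A i t) E z • A i t (y - z)‖ ≤ ((M + r * β) * M + r * M * β) * ‖y - z‖ := by
    intro i _
    have h1 := abs_output_sub_le (B := A i t) (E := E) (hA i t) hy hz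
    rw [sub_self, norm_zero, mul_zero, add_zero, ← hM] at h1
    have h2 := norm_apply_le (E := E) (hA i t) hy
    have h3 := abs_output_le (E := E) (hA i t) hz
    have h4 : ‖A i t (y - z)‖ ≤ β * ‖y - z‖ := (A i t).le_of_opNorm_le (hA i t) _
    refine (norm_add_le _ _).trans ?_
    rw [norm_smul, norm_smul, Real.norm_eq_abs, Real.norm_eq_abs]
    have h5 := mul_le_mul h1 h2 (norm_nonneg _) (by positivity)
    have h6 := mul_le_mul h3 h4 (norm_nonneg _) (by positivity)
    calc _ ≤ _ := add_le_add h5 h6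
      _ = _ := by rw [← hM]; ring
  refine (Finset.sum_le_card_nsmul _ _ _ hterm).trans ?_
  rw [nsmul_eq_mul, Finset.card_univ, ← mul_assoc (Fintype.card ι : ℝ)]

end Feedback

/-! ### Decay of the outputs -/

theorem uniformContinuous_of_periodic {X : Type*} [PseudoMetricSpace X] {f : ℝ → X} {τ : ℝ}
    (hτ : 0 < τ) (hf : Continuous f) (hp : Function.Periodic f τ) : UniformContinuous f := by
  have h :=
    isCompact_Icc.uniformContinuousOn_of_continuous (hf.continuousOn (s := Icc (-τ) (2 * τ)))
  rw [Metric.uniformContinuousOn_iff] at h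
  rw [Metric.uniformContinuous_iff]
  intro ε hε
  obtain ⟨δ, hδ, h⟩ := h ε hε
  refine ⟨min δ τ, lt_min hδ hτ, fun {x y} hxy => ?_⟩
  -- A translation by a multiple of `τ` brings `x` to `[0, τ)`, and then `y` to `[-τ, 2τ]`.
  obtain ⟨n, hn, -⟩ := existsUnique_add_zsmul_mem_Ico hτ x 0
  have h1 := hp.zsmul n x
  have h2 := hp.zsmul n y
  rw [← h1, ← h2]
  rw [Real.dist_eq] at hxy
  have h3 := abs_lt.1 (hxy.trans_le (min_le_right _ _))
  refine h _ ⟨by linarith [hn.1], by linarith [hn.2]⟩ _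
    ⟨by linarith [hn.1], by linarith [hn.2]⟩ ?_
  rw [dist_add_right]
  exact hxy.trans_le (min_le_left _ _)

/-- A form of Barbalat's lemma: if a nonnegative function decreases at least at the rate `u²`,
where `u` is uniformly continuous, then `u` tends to `0`. -/
theorem tendsto_zero_of_dissipation {W W' u : ℝ → ℝ}
    (hW : ∀ t, 0 ≤ t → HasDerivWithinAt W (W' t) (Ici 0) t) (hpos : ∀ t, 0 ≤ W t)
    (hdis : ∀ t, 0 ≤ t → W' t ≤ -u t ^ 2) (hu : UniformContinuousOn u (Ici 0)) :
    Tendsto u atTop (𝓝 0) := by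
  have hanti : AntitoneOn W (Ici 0) := antitoneOn_of_hasDerivWithinAt_nonpos hW fun t ht =>
    (hdis t ht).trans (neg_nonpos.2 (sq_nonneg _))
  obtain ⟨ℓ, hℓ⟩ : ∃ ℓ, Tendsto (fun t => W (max t 0)) atTop (𝓝 ℓ) := by
    refine ⟨_, tendsto_atTop_ciInf (fun s t hst => ?_) ⟨0, ?_⟩⟩
    · exact hanti (mem_Ici.2 (le_max_right _ _)) (mem_Ici.2 (le_max_right _ _))
        (max_le_max_right _ hst)
    · rintro _ ⟨t, rfl⟩; exact hpos _
  rw [Metric.tendsto_atTop]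
  intro ε hε
  rw [Metric.uniformContinuousOn_iff] at hu
  obtain ⟨δ, hδ, hu⟩ := hu (ε / 2) (by linarith)
  -- If `|u t| ≥ ε`, then `|u| ≥ ε / 2` on `[t, t + δ / 2]`, so `W` drops by `(ε / 2)² δ / 2` there,
  -- which is more than it still varies after `t₀`.
  have hη : 0 < (ε / 2) ^ 2 * (δ / 2) := by positivity
  rw [Metric.tendsto_atTop] at hℓ
  obtain ⟨t₀, ht₀⟩ := hℓ ((ε / 2) ^ 2 * (δ / 2) / 2) (by positivity)
  refine ⟨max t₀ 0, fun t ht => ?_⟩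
  have ht0 : 0 ≤ t := (le_max_right _ _).trans ht
  by_contra hlt
  rw [Real.dist_eq, sub_zero, not_lt] at hlt
  have hmono : AntitoneOn (fun s => W s + (ε / 2) ^ 2 * s) (Icc t (t + δ / 2)) := by
    have hd : ∀ s ∈ Ioo t (t + δ / 2),
        HasDerivAt (fun s => W s + (ε / 2) ^ 2 * s) (W' s + (ε / 2) ^ 2 * 1) s := fun s hs =>
      ((hW s (ht0.trans hs.1.le)).hasDerivAt (Ici_mem_nhds (ht0.trans_lt hs.1))).add
        ((hasDerivAt_id s).const_mul _)
    refine antitoneOn_of_deriv_nonpos (convex_Icc _ _) (fun s hs => ?_) ?_ ?_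
    · exact (((hW s (ht0.trans hs.1)).continuousWithinAt.mono
        (fun x hx => ht0.trans hx.1))).add (by fun_prop)
    · rw [interior_Icc]
      exact fun s hs => (hd s hs).differentiableAt.differentiableWithinAt
    · rw [interior_Icc]
      intro s hs
      rw [(hd s hs).deriv]
      have h1 := hdis s (ht0.trans hs.1.le)
      have h2 := hu t ht0 s (ht0.trans hs.1.le) (by
        rw [Real.dist_eq, abs_sub_comm, abs_of_pos (by linarith [hs.1])]; linarith [hs.2])
      rw [Real.dist_eq] at h2
      have h3 : ε / 2 ≤ |u s| := by
        have := abs_sub_abs_le_abs_sub (u t) (u s)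
        linarith
      have h4 : (ε / 2) ^ 2 ≤ u s ^ 2 := by
        rw [← sq_abs (u s)]; gcongr
      linarith
  have h1 := hmono ⟨le_rfl, by linarith⟩ ⟨by linarith, le_rfl⟩ (by linarith : t ≤ t + δ / 2)
  simp only at h1
  have h2 := ht₀ t ((le_max_left _ _).trans ht)
  have h3 := ht₀ (t + δ / 2) (((le_max_left _ _).trans ht).trans (by linarith))
  rw [max_eq_left ht0, Real.dist_eq] at h2
  rw [max_eq_left (by linarith), Real.dist_eq] at h3
  have h4 := abs_lt.1 h2
  have h5 := abs_lt.1 h3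
  linarith

/-- Along a trajectory of the closed-loop system, every output vanishes asymptotically, even with
the time argument of the operators frozen: the outputs tend to `0` by Barbalat's lemma, hence so
does the velocity, and the state is asymptotically constant over a period. -/
theorem tendsto_output {ι : Type*} [Fintype ι] {A : ι → ℝ → V →L[ℝ] V} {τ : ℝ} (hτ : 0 < τ)
    (hA : ∀ i, Continuous (A i)) (hp : ∀ i, Function.Periodic (A i) τ) {β : ℝ}
    (hβ : ∀ i t, ‖A i t‖ ≤ β) (E : V) {y : ℝ → V}
    (hy : ∀ t, 0 ≤ t → HasDerivWithinAt y (feedback A E t (y t)) (Ici 0) t) (i : ι) (s : ℝ) :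
    Tendsto (fun t => output (A i s) E (y t)) atTop (𝓝 0) := by
  set r := ‖y 0‖ with hr
  have hb : ∀ t, 0 ≤ t → ‖y t‖ ≤ r := fun t ht =>
    norm_antitoneOn hy (fun t _ => inner_feedback_nonpos A E t _) (mem_Ici.2 le_rfl)
      (mem_Ici.2 ht) ht
  have β0 : 0 ≤ β := (norm_nonneg _).trans (hβ i 0)
  set M := β * (r + ‖E‖) with hM
  have r0 : 0 ≤ r := norm_nonneg _
  have M0 : 0 ≤ M := by positivity
  have hfb : ∀ t, 0 ≤ t → ‖feedback A E t (y t)‖ ≤ ∑ j, |output (A j t) E (y t)| * M := by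
    intro t ht
    rw [feedback, norm_neg]
    refine (norm_sum_le _ _).trans (Finset.sum_le_sum fun j _ => ?_)
    rw [norm_smul, Real.norm_eq_abs]
    gcongr
    exact norm_apply_le (hβ j t) (hb t ht)
  have hfb2 : ∀ t ∈ Ici (0 : ℝ), ‖feedback A E t (y t)‖ ≤ Fintype.card ι * (r * M * M) := by
    intro t ht
    refine (hfb t ht).trans ((Finset.sum_le_card_nsmul _ _ (r * M * M) fun j _ => ?_).trans ?_)
    · gcongr
      exact abs_output_le (hβ j t) (hb t ht)
    · rw [nsmul_eq_mul, Finset.card_univ]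
  have hlip : ∀ t ∈ Ici (0 : ℝ), ∀ t' ∈ Ici (0 : ℝ),
      ‖y t' - y t‖ ≤ Fintype.card ι * (r * M * M) * ‖t' - t‖ := fun t ht t' ht' =>
    (convex_Ici 0).norm_image_sub_le_of_norm_hasDerivWithin_le hy hfb2 ht ht'
  have huc : ∀ j, UniformContinuousOn (fun t => output (A j t) E (y t)) (Ici 0) := by
    intro j
    have hAu := uniformContinuous_of_periodic hτ (hA j) (hp j)
    rw [Metric.uniformContinuous_iff] at hAu
    rw [Metric.uniformContinuousOn_iff]
    intro ε hε
    set C₁ := M + r * β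
    set C₂ := r * (r + ‖E‖)
    set C₃ := Fintype.card ι * (r * M * M)
    have c1 : 0 ≤ C₁ := by positivity
    have c2 : 0 ≤ C₂ := by positivity
    have c3 : 0 ≤ C₃ := by positivity
    obtain ⟨δ, hδ, hAu⟩ := hAu (ε / 2 / (C₂ + 1)) (by positivity)
    refine ⟨min δ (ε / 2 / (C₁ * C₃ + 1)), by positivity, fun t ht t' ht' hd => ?_⟩
    have h1 := abs_output_sub_le (B := A j t') (E := E) (hβ j t) (hb t ht) (hb t' ht')
    have h2 := hAu (hd.trans_le (min_le_left _ _))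
    have h3 := hlip t' ht' t ht
    rw [dist_eq_norm] at h2
    have h4 : ‖t - t'‖ < ε / 2 / (C₁ * C₃ + 1) := by
      rw [← dist_eq_norm]; exact hd.trans_le (min_le_right _ _)
    rw [lt_div_iff₀ (by positivity)] at h2 h4
    rw [Real.dist_eq]
    have h5 : C₁ * ‖y t - y t'‖ ≤ C₁ * (C₃ * ‖t - t'‖) := by gcongr
    have h6 := norm_nonneg (A j t - A j t')
    have h7 := norm_nonneg (t - t')
    have h8 : C₂ * ‖A j t - A j t'‖ < ε / 2 := by linarith
    have h9 : C₁ * (C₃ * ‖t - t'‖) < ε / 2 := by linarith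
    linarith
  have hu : ∀ j, Tendsto (fun t => output (A j t) E (y t)) atTop (𝓝 0) := by
    intro j
    refine tendsto_zero_of_dissipation (fun t ht => hasDerivWithinAt_norm_sq (hy t ht))
      (fun t => sq_nonneg _) (fun t ht => ?_) (huc j)
    rw [inner_feedback]
    have h1 : output (A j t) E (y t) ^ 2 ≤ ∑ i, output (A i t) E (y t) ^ 2 :=
      Finset.single_le_sum (f := fun i => output (A i t) E (y t) ^ 2) (fun i _ => sq_nonneg _)
        (Finset.mem_univ j)
    have h2 := sq_nonneg (output (A j t) E (y t))
    linarith
  have hvel : Tendsto (fun t => ∑ j, |output (A j t) E (y t)| * M) atTop (𝓝 0) := by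
    have := tendsto_finsetSum Finset.univ fun j _ => ((hu j).abs.mul_const M)
    simpa using this
  set C₁ := M + r * β
  have c1 : 0 ≤ C₁ := by positivity
  rw [Metric.tendsto_atTop] at hvel ⊢
  intro ε hε
  obtain ⟨t₁, ht₁⟩ := hvel (ε / 2 / (C₁ * τ + 1)) (by positivity)
  have hui := hu i
  rw [Metric.tendsto_atTop] at hui
  obtain ⟨t₂, ht₂⟩ := hui (ε / 2) (by positivity)
  refine ⟨max 0 (max t₁ t₂), fun t ht => ?_⟩
  have ht0 : 0 ≤ t := (le_max_left _ _).trans ht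
  have htt₁ : t₁ ≤ t := ((le_max_left _ _).trans (le_max_right _ _)).trans ht
  have htt₂ : t₂ ≤ t := ((le_max_right _ _).trans (le_max_right _ _)).trans ht
  -- `t'` is a time congruent to `s` modulo `τ`, at distance at most `τ` from `t`.
  obtain ⟨t', ht', hAt⟩ := (hp i).exists_mem_Ico hτ s t
  have hmove : ‖y t - y t'‖ ≤ ε / 2 / (C₁ * τ + 1) * ‖t - t'‖ := by
    refine (convex_Ici t).norm_image_sub_le_of_norm_hasDerivWithin_le
      (f' := fun t => feedback A E t (y t))
      (fun x hx => (hy x (ht0.trans hx)).mono (Ici_subset_Ici.2 ht0)) (fun x hx => ?_)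
      (mem_Ici.2 ht'.1) (mem_Ici.2 le_rfl)
    have h1 := ht₁ x (htt₁.trans hx)
    rw [Real.dist_eq, sub_zero] at h1
    exact (hfb x (ht0.trans hx)).trans ((le_abs_self _).trans h1.le)
  have hτ' : ‖t - t'‖ ≤ τ := by
    rw [Real.norm_eq_abs, abs_sub_comm, abs_of_nonneg (by linarith [ht'.1])]; linarith [ht'.2]
  have h1 := abs_output_sub_le (B := A i s) (E := E) (hβ i s) (hb t ht0) (hb t' (ht0.trans ht'.1))
  rw [sub_self, norm_zero, mul_zero, add_zero] at h1
  have h2 := ht₂ t' (htt₂.trans ht'.1)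
  rw [Real.dist_eq, sub_zero, ← hAt] at h2
  rw [Real.dist_eq, sub_zero]
  have h3 : C₁ * ‖y t - y t'‖ ≤ ε / 2 := by
    calc C₁ * ‖y t - y t'‖ ≤ C₁ * (ε / 2 / (C₁ * τ + 1) * τ) := by
          refine mul_le_mul_of_nonneg_left (hmove.trans ?_) c1
          gcongr
      _ = ε / 2 * ((C₁ * τ) / (C₁ * τ + 1)) := by ring
      _ ≤ ε / 2 * 1 := by
          gcongr
          exact (div_le_one (by positivity)).2 (by linarith)
      _ = ε / 2 := mul_one _
  have h4 := abs_sub_abs_le_abs_sub (output (A i s) E (y t)) (output (A i s) E (y t'))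
  linarith

end Evolution

/-! ### Weak limits along ultrafilters -/

section WeakLimit

variable {V : Type*} [NormedAddCommGroup V] [InnerProductSpace ℝ V] [CompleteSpace V]

/-- A bounded family in a Hilbert space converges weakly along every ultrafilter. -/
theorem exists_weak_limit {ι : Type*} (U : Ultrafilter ι) {N : ι → V} {M : ℝ}
    (hN : ∀ᶠ i in U, ‖N i‖ ≤ M) :
    ∃ N' : V, ∀ φ : V →L[ℝ] ℝ, Tendsto (fun i => φ (N i)) U (𝓝 (φ N')) := by
  let f : ι → WeakDual ℝ V := fun i => StrongDual.toWeakDual (InnerProductSpace.toDual ℝ V (N i))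
  have hmem : WeakDual.toStrongDual ⁻¹' Metric.closedBall (0 : StrongDual ℝ V) M ∈ U.map f := by
    rw [Ultrafilter.mem_map]
    filter_upwards [hN] with i hi
    change InnerProductSpace.toDual ℝ V (N i) ∈ Metric.closedBall (0 : StrongDual ℝ V) M
    rw [mem_closedBall_zero_iff, LinearIsometryEquiv.norm_map]
    exact hi
  obtain ⟨g, -, hg⟩ := (WeakDual.isCompact_closedBall (0 : StrongDual ℝ V) M).ultrafilter_le_nhds'
    (U.map f) hmem
  refine ⟨(InnerProductSpace.toDual ℝ V).symm (WeakDual.toStrongDual g), fun φ => ?_⟩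
  set v := (InnerProductSpace.toDual ℝ V).symm φ with hv
  have hφ : ∀ w, φ w = inner ℝ w v := fun w => by
    rw [real_inner_comm, hv, InnerProductSpace.toDual_symm_apply]
  have h1 : Tendsto (fun i => f i v) U (𝓝 (g v)) :=
    ((WeakDual.eval_continuous v).tendsto g).comp hg
  have h2 : inner ℝ ((InnerProductSpace.toDual ℝ V).symm (WeakDual.toStrongDual g)) v = g v := by
    rw [InnerProductSpace.toDual_symm_apply]; rfl
  simp only [hφ]
  rw [h2]
  exact h1

omit [CompleteSpace V] in
theorem tendsto_toWeakSpace {ι : Type*} {l : Filter ι} {N : ι → V} {N' : V}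
    (h : ∀ φ : V →L[ℝ] ℝ, Tendsto (fun i => φ (N i)) l (𝓝 (φ N'))) :
    Tendsto (fun i => toWeakSpace ℝ V (N i)) l (𝓝 (toWeakSpace ℝ V N')) := by
  have hinj : Function.Injective (topDualPairing ℝ V).flip := by
    intro x y hxy
    refine ext_inner_left ℝ fun z => ?_
    exact LinearMap.congr_fun hxy (innerSL ℝ z)
  exact (WeakBilin.tendsto_iff_forall_eval_tendsto _ hinj).2 h

omit [CompleteSpace V] in
/-- A quadratic form `x ↦ ⟪x + v, B x⟫` converges along a weakly convergent family as soon as its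
second order part does. -/
theorem tendsto_inner_of_weak {ι : Type*} {l : Filter ι} {N : ι → V} {N' : V}
    (h : ∀ φ : V →L[ℝ] ℝ, Tendsto (fun i => φ (N i)) l (𝓝 (φ N'))) (B : V →L[ℝ] V) (v : V)
    (hq : Tendsto (fun i => inner ℝ (N i - N') (B (N i - N'))) l (𝓝 0)) :
    Tendsto (fun i => inner ℝ (N i + v) (B (N i))) l (𝓝 (inner ℝ (N' + v) (B N'))) := by
  have hl1 := h ((innerSL ℝ (N' + v)).comp B)
  have hl2 := h (innerSL ℝ (B N'))
  have hsum := (hq.add hl1).add (hl2.sub_const (innerSL ℝ (B N') N'))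
  rw [sub_self, add_zero, zero_add] at hsum
  refine Tendsto.congr (fun i => ?_) hsum
  simp only [ContinuousLinearMap.comp_apply, innerSL_apply_apply]
  rw [real_inner_comm (N i) (B N'), real_inner_comm N' (B N')]
  simp only [map_sub, inner_sub_left, inner_sub_right, inner_add_left]
  ring

end WeakLimit

namespace H1

variable {a b : ℝ} [hab : Fact (a < b)]

section Convergence

variable {ι : Type*} {U : Ultrafilter ι} {N : ι → H1 a b} {N' : H1 a b}

theorem tendsto_rep_of_weak (h : ∀ φ : H1 a b →L[ℝ] ℝ, Tendsto (fun i => φ (N i)) U (𝓝 (φ N')))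
    {x : ℝ} (hx : x ∈ Icc a b) : Tendsto (fun i => (N i).rep x) U (𝓝 (N'.rep x)) := by
  have hpi : Tendsto (fun i => ((N i).rep x).ofLp) U (𝓝 (N'.rep x).ofLp) :=
    tendsto_pi_nhds.2 fun j => h ((EuclideanSpace.proj j).comp (ev x hx))
  exact ((PiLp.continuous_toLp 2 fun _ : Fin 3 => ℝ).tendsto _).comp hpi

/-- Weak convergence in `H¹` along an ultrafilter implies uniform convergence: if the distances
were at least `ε` at points `xᵢ`, they would be close to `ε` at the limit of the `xᵢ`, by Hölder
continuity. -/
theorem eventually_norm_rep_sub_lt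
    (h : ∀ φ : H1 a b →L[ℝ] ℝ, Tendsto (fun i => φ (N i)) U (𝓝 (φ N')))
    {M : ℝ} (hM : ∀ᶠ i in U, ‖N i‖ ≤ M) {ε : ℝ} (hε : 0 < ε) :
    ∀ᶠ i in U, ∀ x ∈ Icc a b, ‖(N i - N').rep x‖ < ε := by
  by_contra hcon
  rw [← Ultrafilter.eventually_not] at hcon
  simp only [not_forall, not_lt] at hcon
  have : Nonempty ℝ := ⟨0⟩
  choose! x hx hxε using fun i (hi : ∃ x, ∃ _ : x ∈ Icc a b, ε ≤ ‖(N i - N').rep x‖) => hi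
  have hmem : Icc a b ∈ U.map x := by
    rw [Ultrafilter.mem_map]
    exact hcon.mono fun i hi => hx i hi
  obtain ⟨z, hz, hlim⟩ := (isCompact_Icc (a := a) (b := b)).ultrafilter_le_nhds' (U.map x) hmem
  have hlim' : Tendsto x U (𝓝 z) := hlim
  have h1 : Tendsto (fun i => ‖(N i - N').rep z‖) U (𝓝 0) := by
    have h2 := (tendsto_rep_of_weak h hz).sub_const (N'.rep z)
    rw [sub_self] at h2
    have h3 : ∀ i, (N i - N').rep z = (N i).rep z - N'.rep z := fun i => (ev z hz).map_sub _ _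
    simp only [h3]
    exact tendsto_zero_iff_norm_tendsto_zero.1 h2
  have h4 : Tendsto (fun i => √|x i - z| * (M + ‖N'‖)) U (𝓝 0) := by
    have h5 : Tendsto (fun i => √|x i - z|) U (𝓝 √|z - z|) :=
      (hlim'.sub_const z).abs.sqrt
    rw [sub_self, abs_zero, Real.sqrt_zero] at h5
    simpa using h5.mul_const (M + ‖N'‖)
  have h6 := h1.add h4
  rw [add_zero] at h6
  have h7 : ∀ᶠ i in U, ε ≤ ‖(N i - N').rep z‖ + √|x i - z| * (M + ‖N'‖) := by
    filter_upwards [hcon, hM] with i hi hMi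
    have h8 := (N i - N').norm_rep_sub_le (hx i hi) hz
    have h9 : ‖N i - N'‖ ≤ M + ‖N'‖ := (norm_sub_le _ _).trans (by linarith)
    have h10 : √|x i - z| * ‖N i - N'‖ ≤ √|x i - z| * (M + ‖N'‖) := by gcongr
    have h11 := norm_le_norm_add_norm_sub ((N i - N').rep z) ((N i - N').rep (x i))
    rw [norm_sub_rev] at h11
    have h12 := hxε i hi
    linarith
  have := ge_of_tendsto h6 h7
  linarith

/-- The quadratic form `n ↦ ⟪n, W ∧ n⟫` involves `n'` only linearly. -/
theorem inner_self_wedgeH1 (n W : H1 a b) :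
    inner ℝ n (wedgeH1 W n) = inner ℝ n.1.snd ((memLp_wedge_der W n).toLp _) := by
  have h1 : ∫ x, inner ℝ (n.val x) ((wedgeH1 W n).val x) ∂(leb a b) = 0 := by
    refine integral_eq_zero_of_ae ?_
    filter_upwards [(wedgeH1 W n).rep_ae, n.rep_ae, ae_leb_mem a b] with x h1 h2 hx
    rw [← h1, ← h2, rep_wedgeH1 _ _ (Ioo_subset_Icc_self hx), inner_self_wedge]
    rfl
  have h2 : inner ℝ n.1.snd ((memLp_wedge_der W n).toLp _) = ∫ x, inner ℝ (n.der x)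
      ((memLp_wedge_der W n).toLp _ x) ∂(leb a b) := L2.inner_def _ _
  rw [inner_eq, h1, zero_add, h2]
  refine integral_congr_ae ?_
  filter_upwards [der_wedgeH1 W n, (memLp_wedge_der W n).coeFn_toLp] with x h1 h2
  rw [h1, h2, inner_add_right, inner_self_wedge, zero_add]

theorem abs_inner_self_wedgeH1_le (n W : H1 a b) {ε : ℝ} (hn : ∀ x ∈ Icc a b, ‖n.rep x‖ ≤ ε) :
    |inner ℝ n (wedgeH1 W n)| ≤ ‖n‖ * (‖wedgeL‖ * ε * ‖W‖) := by
  have hε : 0 ≤ ε := (norm_nonneg _).trans (hn a (left_mem_Icc.2 hab.out.le))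
  rw [inner_self_wedgeH1]
  refine (abs_real_inner_le_norm _ _).trans ?_
  have h1 : ‖(memLp_wedge_der W n).toLp _‖ ≤ ‖wedgeL‖ * ε * ‖W.1.snd‖ := by
    refine Lp.norm_le_mul_norm_of_ae_le_mul ?_
    filter_upwards [(memLp_wedge_der W n).coeFn_toLp, ae_leb_mem a b] with x hx hm
    rw [hx]
    refine (wedgeL.le_opNorm₂ _ _).trans ?_
    have h2 := hn x (Ioo_subset_Icc_self hm)
    calc ‖wedgeL‖ * ‖W.der x‖ * ‖n.rep x‖ ≤ ‖wedgeL‖ * ‖W.der x‖ * ε := by gcongr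
      _ = ‖wedgeL‖ * ε * ‖W.der x‖ := by ring
  exact mul_le_mul n.norm_snd_le (h1.trans (by gcongr; exact W.norm_snd_le)) (norm_nonneg _)
    (norm_nonneg _)

/-- The feedback functionals are weakly continuous on bounded sets. -/
theorem tendsto_inner_wedgeH1
    (h : ∀ φ : H1 a b →L[ℝ] ℝ, Tendsto (fun i => φ (N i)) U (𝓝 (φ N')))
    {M : ℝ} (hM : ∀ᶠ i in U, ‖N i‖ ≤ M) (W v : H1 a b) :
    Tendsto (fun i => inner ℝ (N i + v) (wedgeH1 W (N i))) U
      (𝓝 (inner ℝ (N' + v) (wedgeH1 W N'))) := by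
  have hq : Tendsto (fun i => inner ℝ (N i - N') (wedgeH1 W (N i - N'))) U (𝓝 0) := by
    rw [Metric.tendsto_nhds]
    intro ε hε
    obtain ⟨i₀, hi₀⟩ := hM.exists
    have hM0 : 0 ≤ M := (norm_nonneg _).trans hi₀
    set C := (M + ‖N'‖) * (‖wedgeL‖ * ‖W‖) with hC
    have C0 : 0 ≤ C := by positivity
    filter_upwards [hM, eventually_norm_rep_sub_lt h hM (ε := ε / (C + 1)) (by positivity)]
      with i hi hlt
    have h1 := abs_inner_self_wedgeH1_le (N i - N') W fun x hx => (hlt x hx).le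
    have h2 : ‖N i - N'‖ ≤ M + ‖N'‖ := (norm_sub_le _ _).trans (by linarith)
    rw [Real.dist_eq, sub_zero]
    calc _ ≤ _ := h1
      _ ≤ (M + ‖N'‖) * (‖wedgeL‖ * (ε / (C + 1)) * ‖W‖) := by gcongr
      _ = ε * (C / (C + 1)) := by rw [hC]; ring
      _ < ε * 1 := by
          gcongr
          exact (div_lt_one (by positivity)).2 (by linarith)
      _ = ε := mul_one ε
  exact tendsto_inner_of_weak h (wedgeH1 W) v hq

end Convergence

end H1

/-! ### Invariance and moments -/

/-- If a functional vanishes on the orbit of a pair under rotation, over a time interval, then it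
vanishes on its images under all powers of the generator, by differentiation at time `0`. -/
theorem eq_zero_of_rotPair {V : Type*} [NormedAddCommGroup V] [NormedSpace ℝ V] [CompleteSpace V]
    (X : V →L[ℝ] V) (r : V × V) (ℓ : V →L[ℝ] ℝ) {T : ℝ} (hT : 0 < T)
    (h : ∀ s ∈ Icc 0 T, ℓ (H1.rotPair X r s).1 = 0 ∧ ℓ (H1.rotPair X r s).2 = 0) (k : ℕ) :
    ℓ ((X ^ k) r.1) = 0 ∧ ℓ ((X ^ k) r.2) = 0 := by
  have key : ∀ k : ℕ, ∀ s ∈ Icc 0 T, ℓ ((X ^ k) (H1.rotPair X r s).1) = 0 ∧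
      ℓ ((X ^ k) (H1.rotPair X r s).2) = 0 := by
    intro k
    induction k with
    | zero => simpa using h
    | succ k ih =>
      intro s hs
      have hd := H1.hasDerivAt_rotPair X r s
      have hu : UniqueDiffWithinAt ℝ (Icc 0 T) s := uniqueDiffOn_Icc hT s hs
      have hz : ∀ f : ℝ → ℝ, (∀ s ∈ Icc 0 T, f s = 0) → ∀ f' : ℝ, HasDerivAt f f' s → f' = 0 := by
        intro f hf f' hf'
        have h1 : HasDerivWithinAt f 0 (Icc 0 T) s :=
          (hasDerivWithinAt_const s (Icc 0 T) (0 : ℝ)).congr hf (hf s hs)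
        exact hu.eq_deriv _ hf'.hasDerivWithinAt h1
      have d1 := ((ℓ.comp (X ^ k)).comp
        (ContinuousLinearMap.fst ℝ V V)).hasFDerivAt.comp_hasDerivAt s hd
      have d2 := ((ℓ.comp (X ^ k)).comp
        (ContinuousLinearMap.snd ℝ V V)).hasFDerivAt.comp_hasDerivAt s hd
      have e1 := hz _ (fun s hs => (ih s hs).1) _ d1
      have e2 := hz _ (fun s hs => (ih s hs).2) _ d2
      simp only [ContinuousLinearMap.comp_apply, ContinuousLinearMap.coe_fst',
        ContinuousLinearMap.coe_snd', map_neg, neg_eq_zero] at e1 e2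
      exact ⟨by rw [pow_succ]; exact e2, by rw [pow_succ]; exact e1⟩
  have := key k 0 ⟨le_rfl, hT.le⟩
  rwa [H1.rotPair_zero] at this

section Moments

variable {a b : ℝ}

theorem integrable_continuous_mul {φ h : ℝ → ℝ} (hφ : Continuous φ) (hh : Integrable h (leb a b)) :
    Integrable (fun x => φ x * h x) (leb a b) := by
  obtain ⟨C, hC⟩ := isCompact_Icc.exists_bound_of_continuousOn (hφ.continuousOn (s := Icc a b))
  refine hh.bdd_mul hφ.aestronglyMeasurable (c := C) ?_
  filter_upwards [ae_leb_mem a b] with x hx using hC x (Ioo_subset_Icc_self hx)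

/-- An integrable function on a bounded interval, all of whose moments vanish, is zero. -/
theorem ae_eq_zero_of_moments {h : ℝ → ℝ} (hh : Integrable h (leb a b))
    (hm : ∀ k : ℕ, ∫ x, x ^ k * h x ∂(leb a b) = 0) : h =ᵐ[leb a b] 0 := by
  have hpoly : ∀ P : Polynomial ℝ, ∫ x, P.eval x * h x ∂(leb a b) = 0 := by
    intro P
    induction P using Polynomial.induction_on' with
    | add P Q hP hQ =>
      simp only [Polynomial.eval_add, add_mul]
      rw [integral_add (integrable_continuous_mul P.continuous hh)
        (integrable_continuous_mul Q.continuous hh), hP, hQ, add_zero]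
    | monomial n c =>
      simp only [Polynomial.eval_monomial, mul_assoc]
      rw [integral_const_mul, hm, mul_zero]
  have hcont : ∀ φ : ℝ → ℝ, Continuous φ → ∫ x, φ x * h x ∂(leb a b) = 0 := by
    intro φ hφ
    set I := ∫ x, ‖h x‖ ∂(leb a b) with hI
    have I0 : 0 ≤ I := integral_nonneg fun x => norm_nonneg _
    refine abs_eq_zero.1 (le_antisymm (le_of_forall_pos_le_add fun ε hε => ?_) (abs_nonneg _))
    obtain ⟨P, hP⟩ := exists_polynomial_near_of_continuousOn a b φ hφ.continuousOn (ε / (I + 1))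
      (by positivity)
    have e : ∫ x, φ x * h x ∂(leb a b) = ∫ x, (φ x - P.eval x) * h x ∂(leb a b) := by
      simp only [sub_mul]
      rw [integral_sub (integrable_continuous_mul hφ hh)
        (integrable_continuous_mul P.continuous hh), hpoly, sub_zero]
    rw [e, ← Real.norm_eq_abs, zero_add]
    have hb : ∀ᵐ x ∂(leb a b), ‖(φ x - P.eval x) * h x‖ ≤ ε / (I + 1) * ‖h x‖ := by
      filter_upwards [ae_leb_mem a b] with x hx
      rw [norm_mul]
      gcongr
      rw [norm_sub_rev]
      exact (hP x (Ioo_subset_Icc_self hx)).le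
    refine (norm_integral_le_of_norm_le (hh.norm.const_mul _) hb).trans ?_
    rw [integral_const_mul, ← hI]
    calc ε / (I + 1) * I = ε * (I / (I + 1)) := by ring
      _ ≤ ε * 1 := by
          gcongr
          exact (div_le_one (by positivity)).2 (by linarith)
      _ = ε := mul_one ε
  have hs : ∀ᵐ x, x ∈ Ioo a b → h x = 0 := by
    refine isOpen_Ioo.ae_eq_zero_of_integral_contDiff_smul_eq_zero
      (IntegrableOn.locallyIntegrableOn hh) fun φ h1 _ h3 => ?_
    rw [← hcont φ h1.continuous, eq_comm, setIntegral_eq_integral_of_forall_compl_eq_zero]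
    · rfl
    · intro x hx
      rw [image_eq_zero_of_notMem_tsupport fun h => hx (h3 h), zero_mul]
  rw [Filter.EventuallyEq, ae_restrict_iff' measurableSet_Ioo]
  exact hs

theorem hasACDeriv_pow (a b : ℝ) (k : ℕ) :
    HasACDeriv a b (fun x : ℝ => x ^ k) (fun x => k * x ^ (k - 1)) := by
  have h : HasACDeriv a b (fun x : ℝ => x ^ k) (deriv fun x : ℝ => x ^ k) :=
    HasACDeriv.of_contDiff (contDiff_id.pow k)
  exact h.congr_ae (Eventually.of_forall fun x => by simp)

/-- If the functional `φ ↦ ∫ (φ q + φ' p)` vanishes on monomials, then it vanishes on all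
absolutely continuous functions. Indeed `p` is then the primitive of `q`, and it vanishes at both
ends of the interval. -/
theorem integral_eq_zero_of_monomials (hab : a ≤ b) {p q : ℝ → ℝ} (hp : Integrable p (leb a b))
    (hq : Integrable q (leb a b))
    (h : ∀ k : ℕ, ∫ x, (x ^ k * q x + k * x ^ (k - 1) * p x) ∂(leb a b) = 0)
    {φ φ' : ℝ → ℝ} (hφ : HasACDeriv a b φ φ') :
    Integrable (fun x => φ x * q x + φ' x * p x) (leb a b) ∧
      ∫ x, (φ x * q x + φ' x * p x) ∂(leb a b) = 0 := by
  have hQ := HasACDeriv.integral hab hq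
  set Q : ℝ → ℝ := fun x => ∫ y in a..x, q y with hQdef
  have hQi : Integrable Q (leb a b) := memLp_one_iff_integrable.1 (hQ.memLp 1)
  have hQa : Q a = 0 := intervalIntegral.integral_same
  -- This is the hypothesis for `k = 0`.
  have hQb : Q b = 0 := by
    have h0 := h 0
    simp only [pow_zero, one_mul, CharP.cast_eq_zero, zero_mul, add_zero] at h0
    rw [hQdef, ← h0, integral_leb hab]
  have hprod : ∀ {ψ ψ' : ℝ → ℝ}, HasACDeriv a b ψ ψ' →
      Integrable (fun x => ψ x * q x + ψ' x * Q x) (leb a b) ∧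
      ∫ x, (ψ x * q x + ψ' x * Q x) ∂(leb a b) = 0 := by
    intro ψ ψ' hψ
    have h1 := hψ.smul hQ
    simp only [smul_eq_mul] at h1
    refine ⟨h1.integrable, ?_⟩
    rw [h1.integral_eq_sub hab, hQa, hQb, mul_zero, mul_zero, sub_zero]
  have hpQ : (fun x => p x - Q x) =ᵐ[leb a b] 0 := by
    refine ae_eq_zero_of_moments (hp.sub hQi) fun k => ?_
    have h1 := h (k + 1)
    have h2 := (hprod (hasACDeriv_pow a b (k + 1))).2
    simp only [Nat.add_sub_cancel] at h1 h2
    have c1 : Continuous fun x : ℝ => x ^ (k + 1) := by fun_prop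
    have c2 : Continuous fun x : ℝ => ((k + 1 : ℕ) : ℝ) * x ^ k := by fun_prop
    have c3 : Continuous fun x : ℝ => x ^ k := by fun_prop
    rw [integral_add (integrable_continuous_mul c1 hq) (integrable_continuous_mul c2 hp)] at h1
    rw [integral_add (integrable_continuous_mul c1 hq) (integrable_continuous_mul c2 hQi)] at h2
    have h3 : ∫ x, ((k + 1 : ℕ) : ℝ) * x ^ k * (p x - Q x) ∂(leb a b) = 0 := by
      simp only [mul_sub]
      rw [integral_sub (integrable_continuous_mul c2 hp) (integrable_continuous_mul c2 hQi)]
      linarith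
    simp only [mul_assoc] at h3
    rw [integral_const_mul] at h3
    exact (mul_eq_zero.1 h3).resolve_left (Nat.cast_ne_zero.2 k.succ_ne_zero)
  have hae : (fun x => φ x * q x + φ' x * Q x) =ᵐ[leb a b] fun x => φ x * q x + φ' x * p x := by
    filter_upwards [hpQ] with x hx
    have : p x = Q x := sub_eq_zero.1 hx
    rw [this]
  obtain ⟨h1, h2⟩ := hprod hφ
  exact ⟨h1.congr hae, by rw [← integral_congr_ae hae]; exact h2⟩

end Moments

/-! ### Rigidity of the limit profile -/

namespace H1

variable {a b : ℝ} [hab : Fact (a < b)]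

theorem rep_mulX_pow (r : H1 a b) (k : ℕ) {x : ℝ} (hx : x ∈ Icc a b) :
    ((mulX ^ k) r).rep x = x ^ k • r.rep x := by
  induction k with
  | zero => simp
  | succ k ih =>
    have e : (mulX ^ (k + 1)) r = mulX ((mulX ^ k) r) := by rw [pow_succ']; rfl
    rw [e, rep_mulX _ hx, ih, smul_smul, pow_succ']

/-- For `w` multiplied by a scalar function with value `c` and derivative `c'`. -/
theorem density_smul (n' n w w' : E3) (c c' : ℝ) :
    density n' n (c • w' + c' • w) (c • w)
      = c * density n' n w' w + c' * inner ℝ n' (wedge w n) := by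
  simp only [density, wedge_add_left, wedge_smul_left, inner_add_right, inner_smul_right]
  ring

theorem density_add (n' n w₁ w₁' w₂ w₂' : E3) :
    density n' n (w₁' + w₂') (w₁ + w₂) = density n' n w₁' w₁ + density n' n w₂' w₂ := by
  simp only [density, wedge_add_left, inner_add_right]
  ring

theorem density_self (n' n : E3) : density n' n n' n = 0 := by
  simp only [density, inner_E3, wedge_apply_zero, wedge_apply_one, wedge_apply_two]
  ring

/-- If the functional vanishes on the products of `r` with monomials, then it vanishes on the
products of `r` with absolutely continuous functions. -/
theorem integral_density_eq_zero (N r : H1 a b)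
    (h : ∀ k : ℕ, inner ℝ (N + H1.const a b (e 2)) (wedgeH1 ((mulX ^ k) r) N) = 0)
    {φ φ' : ℝ → ℝ} (hφ : HasACDeriv a b φ φ') :
    Integrable (fun x => density (N.der x) (N.rep x) (φ x • r.der x + φ' x • r.rep x)
        (φ x • r.rep x)) (leb a b) ∧
      ∫ x, density (N.der x) (N.rep x) (φ x • r.der x + φ' x • r.rep x)
        (φ x • r.rep x) ∂(leb a b) = 0 := by
  simp only [density_smul]
  have hw : MemLp (fun x => wedge (r.rep x) (N.rep x)) 2 (leb a b) :=
    (r.rep_ac.bilin N.rep_ac wedgeL).memLp 2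
  refine integral_eq_zero_of_monomials hab.out.le
    (integrable_bilin_of_L2 N.memLp_der hw (innerSL ℝ))
    (integrable_density N (r.rep_ac.memLp 2) r.memLp_der) (fun k => ?_) hφ
  rw [← h k, inner_wedgeH1]
  have hder := ((mulX ^ k) r).rep_ac.ae_eq ((hasACDeriv_pow a b k).smul r.rep_ac)
    fun x hx => rep_mulX_pow r k hx
  refine integral_congr_ae ?_
  filter_upwards [hder, ae_leb_mem a b] with x h1 hx
  rw [h1, rep_mulX_pow r k (Ioo_subset_Icc_self hx), density_smul]
  rfl

/-- On the sphere, the integrand at the field `N ∧ e₃`. -/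
theorem density_wedge_e3 (n' n : E3) (h1 : inner ℝ n n = (1 : ℝ)) (h0 : inner ℝ n' n = (0 : ℝ)) :
    density n' n (wedge n' (e 2)) (wedge n (e 2)) = -n 2 * inner ℝ n' n' + (1 - n 2 ^ 2) := by
  simp only [density, inner_E3, wedge_apply_zero, wedge_apply_one, wedge_apply_two, e,
    EuclideanSpace.single, PiLp.single_apply] at h0 h1 ⊢
  simp
  linear_combination (n' 2) * h0 + h1

/-- A profile with values in the sphere, below the equator, on which the functionals of all
products of two columns of the frame with monomials vanish, is constant equal to `-e₃`, as long as
it is nowhere orthogonal to the third column. The field `N ∧ e₃` is a combination of the first two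
columns and `N` with absolutely continuous coefficients, so the functional vanishes on it; but its
value there is `∫ (-N₃ |N'|² + 1 - N₃²)`. -/
theorem eq_neg_e3_of_rigid (N r₁ r₂ r₃ : H1 a b) {c : ℝ} (hc : 0 < c)
    (hdec : ∀ x ∈ Icc a b, ∀ v : E3, v = (inner ℝ v (r₁.rep x) : ℝ) • r₁.rep x
      + (inner ℝ v (r₂.rep x) : ℝ) • r₂.rep x + (inner ℝ v (r₃.rep x) : ℝ) • r₃.rep x)
    (hN : ∀ x ∈ Icc a b, ‖N.rep x‖ = 1) (hneg : ∀ x ∈ Icc a b, N.rep x 2 < 0)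
    (hθ : ∀ x ∈ Icc a b, c ≤ |inner ℝ (N.rep x) (r₃.rep x)|)
    (h₁ : ∀ k : ℕ, inner ℝ (N + H1.const a b (e 2)) (wedgeH1 ((mulX ^ k) r₁) N) = 0)
    (h₂ : ∀ k : ℕ, inner ℝ (N + H1.const a b (e 2)) (wedgeH1 ((mulX ^ k) r₂) N) = 0) :
    ∀ x ∈ Icc a b, N.rep x = -e 2 := by
  have hle := hab.out.le
  have hW := N.rep_ac.clm (wedgeL.flip (e 2))
  simp only [ContinuousLinearMap.flip_apply, wedgeL_apply] at hW
  -- `ψ` is the coefficient of `N`, determined by the third component.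
  obtain ⟨ψ, ψ', hψ, hψv⟩ : ∃ ψ ψ' : ℝ → ℝ, HasACDeriv a b ψ ψ' ∧ ∀ x ∈ Icc a b,
      ψ x * inner ℝ (N.rep x) (r₃.rep x) = inner ℝ (wedge (N.rep x) (e 2)) (r₃.rep x) := by
    have hinv := (N.rep_ac.inner r₃.rep_ac).inv hc (by rwa [uIcc_of_le hle])
    refine ⟨_, _, (hW.inner r₃.rep_ac).smul hinv, fun x hx => ?_⟩
    have hne : (inner ℝ (N.rep x) (r₃.rep x) : ℝ) ≠ 0 := fun h0 => by
      have := hθ x hx; rw [h0, abs_zero] at this; linarith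
    rw [smul_eq_mul, mul_assoc, inv_mul_cancel₀ hne, mul_one]
  have hu := hW.sub (hψ.smul N.rep_ac)
  obtain ⟨α, α', hα, hαv⟩ : ∃ α α' : ℝ → ℝ, HasACDeriv a b α α' ∧ ∀ x,
      α x = inner ℝ (wedge (N.rep x) (e 2) - ψ x • N.rep x) (r₁.rep x) :=
    ⟨_, _, hu.inner r₁.rep_ac, fun _ => rfl⟩
  obtain ⟨β, β', hβ, hβv⟩ : ∃ β β' : ℝ → ℝ, HasACDeriv a b β β' ∧ ∀ x,
      β x = inner ℝ (wedge (N.rep x) (e 2) - ψ x • N.rep x) (r₂.rep x) :=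
    ⟨_, _, hu.inner r₂.rep_ac, fun _ => rfl⟩
  have hsum := ((hα.smul r₁.rep_ac).add (hβ.smul r₂.rep_ac)).add (hψ.smul N.rep_ac)
  have heq : ∀ x ∈ Icc a b, wedge (N.rep x) (e 2)
      = α x • r₁.rep x + β x • r₂.rep x + ψ x • N.rep x := fun x hx => by
    have h1 := hdec x hx (wedge (N.rep x) (e 2) - ψ x • N.rep x)
    have h3 : (inner ℝ (wedge (N.rep x) (e 2) - ψ x • N.rep x) (r₃.rep x) : ℝ) = 0 := by
      rw [inner_sub_left, real_inner_smul_left, hψv x hx, sub_self]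
    rw [h3, zero_smul, add_zero, ← hαv, ← hβv] at h1
    exact sub_eq_iff_eq_add.1 h1
  have hder := hW.ae_eq hsum heq
  obtain ⟨i1, z1⟩ := integral_density_eq_zero N r₁ h₁ hα
  obtain ⟨i2, z2⟩ := integral_density_eq_zero N r₂ h₂ hβ
  have htot : ∫ x, density (N.der x) (N.rep x) (wedge (N.der x) (e 2)) (wedge (N.rep x) (e 2))
      ∂(leb a b) = 0 := by
    have h4 := integral_add i1 i2
    rw [z1, z2, add_zero] at h4
    rw [← h4]
    refine integral_congr_ae ?_
    filter_upwards [hder, ae_leb_mem a b] with x hx hm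
    rw [hx, heq x (Ioo_subset_Icc_self hm), density_add, density_add, density_smul _ _ (N.rep x),
      density_self, wedge_self, inner_zero_right]
    simp
  have hint : Integrable (fun x => density (N.der x) (N.rep x) (wedge (N.der x) (e 2))
      (wedge (N.rep x) (e 2))) (leb a b) :=
    integrable_density N (hW.memLp 2) ((wedgeL.flip (e 2)).comp_memLp' N.memLp_der)
  have horth : ∀ᵐ x ∂(leb a b), inner ℝ (N.der x) (N.rep x) = (0 : ℝ) := by
    have h5 := (N.rep_ac.inner N.rep_ac).ae_eq (HasACDeriv.const (1 : ℝ)) fun x hx => by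
      rw [real_inner_self_eq_norm_sq, hN x hx, one_pow]
    filter_upwards [h5] with x hx
    rw [real_inner_comm (N.der x)] at hx
    linarith
  have hval : ∀ᵐ x ∂(leb a b), density (N.der x) (N.rep x) (wedge (N.der x) (e 2))
      (wedge (N.rep x) (e 2)) = -N.rep x 2 * inner ℝ (N.der x) (N.der x) + (1 - N.rep x 2 ^ 2) := by
    filter_upwards [horth, ae_leb_mem a b] with x hx hm
    refine density_wedge_e3 _ _ ?_ hx
    rw [real_inner_self_eq_norm_sq, hN x (Ioo_subset_Icc_self hm), one_pow]
  have hcoord : ∀ x ∈ Icc a b, N.rep x 0 ^ 2 + N.rep x 1 ^ 2 + N.rep x 2 ^ 2 = 1 := by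
    intro x hx
    have h6 := real_inner_self_eq_norm_sq (N.rep x)
    rw [hN x hx, inner_E3] at h6
    linarith
  have hnn : 0 ≤ᵐ[leb a b] fun x => density (N.der x) (N.rep x) (wedge (N.der x) (e 2))
      (wedge (N.rep x) (e 2)) := by
    filter_upwards [hval, ae_leb_mem a b] with x hx hm
    have hm' := Ioo_subset_Icc_self hm
    rw [hx]
    have h7 : (0 : ℝ) ≤ inner ℝ (N.der x) (N.der x) := real_inner_self_nonneg
    have h8 := hneg x hm'
    have h9 := hcoord x hm'
    have h10 : 0 ≤ -N.rep x 2 * inner ℝ (N.der x) (N.der x) := mul_nonneg (by linarith) h7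
    change (0 : ℝ) ≤ _
    nlinarith [sq_nonneg (N.rep x 0), sq_nonneg (N.rep x 1)]
  have hzero := (integral_eq_zero_iff_of_nonneg_ae hnn hint).1 htot
  refine eqOn_Icc_of_ae_eq_leb hab.out ?_ N.rep_ac.continuousOn_Icc continuousOn_const
  filter_upwards [hzero, hval, ae_leb_mem a b] with x h0 hx hm
  have hm' := Ioo_subset_Icc_self hm
  rw [hx] at h0
  change _ = (0 : ℝ) at h0
  have h7 : (0 : ℝ) ≤ inner ℝ (N.der x) (N.der x) := real_inner_self_nonneg
  have h8 := hneg x hm'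
  have h9 := hcoord x hm'
  have h10 : 0 ≤ -N.rep x 2 * inner ℝ (N.der x) (N.der x) := mul_nonneg (by linarith) h7
  have h11 : N.rep x 0 ^ 2 + N.rep x 1 ^ 2 = 0 := by
    nlinarith [sq_nonneg (N.rep x 0), sq_nonneg (N.rep x 1)]
  have h12 : N.rep x 0 = 0 := by nlinarith [sq_nonneg (N.rep x 0), sq_nonneg (N.rep x 1)]
  have h13 : N.rep x 1 = 0 := by nlinarith [sq_nonneg (N.rep x 0), sq_nonneg (N.rep x 1)]
  have h14 : N.rep x 2 = -1 := by
    rw [h12, h13] at h9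
    nlinarith
  refine E3_ext ?_ ?_ ?_
  · rw [h12]; simp [e]
  · rw [h13]; simp [e]
  · rw [h14]; simp [e]

end H1

/-! ### The primitive of the switching sign -/

section Sigma

variable {T : ℝ}

theorem abs_eps (T t : ℝ) : |eps T t| = 1 := by
  rw [eps, abs_zpow, abs_neg, abs_one, one_zpow]

theorem intervalIntegrable_eps (T x y : ℝ) : IntervalIntegrable (eps T) volume x y := by
  have hm : Measurable (eps T) :=
    (Measurable.of_discrete (f := fun n : ℤ => (-1 : ℝ) ^ n)).comp
      (Int.measurable_floor.comp (measurable_id.div_const T))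
  refine (intervalIntegrable_const (c := (1 : ℝ))).mono_fun hm.aestronglyMeasurable ?_
  exact Eventually.of_forall fun t => by simp [abs_eps]

theorem continuous_sigma (T : ℝ) : Continuous (sigma T) :=
  intervalIntegral.continuous_primitive (fun x y => intervalIntegrable_eps T x y) 0

theorem antiperiodic_eps (hT : 0 < T) : Function.Antiperiodic (eps T) T := by
  intro t
  rw [eps, eps, add_div, div_self hT.ne', Int.floor_add_one, zpow_add_one₀ (by norm_num)]
  ring

theorem periodic_sigma (hT : 0 < T) : Function.Periodic (sigma T) (2 * T) := by
  intro t
  have hi := intervalIntegrable_eps T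
  have h1 : ∫ s in (T)..(2 * T), eps T s = -∫ s in (0 : ℝ)..T, eps T s := by
    rw [← intervalIntegral.integral_neg, ← intervalIntegral.integral_congr
      (fun s _ => antiperiodic_eps hT s), intervalIntegral.integral_comp_add_right, zero_add,
      two_mul]
  have h2 := (antiperiodic_eps hT).periodic_two_mul.intervalIntegral_add_eq t 0
  rw [zero_add, ← intervalIntegral.integral_add_adjacent_intervals (hi 0 T) (hi T (2 * T)), h1,
    add_neg_cancel] at h2
  rw [sigma, ← intervalIntegral.integral_add_adjacent_intervals (hi 0 t) (hi t (t + 2 * T)), h2,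
    add_zero, sigma]

theorem sigma_eq_self (hT : 0 < T) {s : ℝ} (hs : s ∈ Icc 0 T) : sigma T s = s := by
  have h : ∫ x in (0 : ℝ)..s, eps T x = ∫ x in (0 : ℝ)..s, (1 : ℝ) := by
    refine intervalIntegral.integral_congr_Ioo_of_le hs.1 fun x hx => ?_
    have h0 : ⌊x / T⌋ = 0 := Int.floor_eq_zero_iff.2
      ⟨div_nonneg hx.1.le hT.le, (div_lt_one hT).2 (hx.2.trans_le hs.2)⟩
    simp [eps, h0]
  rw [sigma, h]
  simp

end Sigma

/-! ### Orthonormal columns -/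

theorem inner_act (A : Mat3) (v w : E3) : (inner ℝ v (act A w) : ℝ) = inner ℝ (act Aᵀ v) w := by
  simp only [inner_E3, act, Matrix.mulVec, dotProduct, Fin.sum_univ_three, Matrix.transpose_apply]
  ring

theorem eq_sum_inner_col {A : Mat3} (hA : A ∈ Matrix.specialOrthogonalGroup (Fin 3) ℝ) (v : E3) :
    v = (inner ℝ v (act A (e 0)) : ℝ) • act A (e 0) + (inner ℝ v (act A (e 1)) : ℝ) • act A (e 1)
      + (inner ℝ v (act A (e 2)) : ℝ) • act A (e 2) := by
  have h1 : A * Aᵀ = 1 := (Matrix.mem_orthogonalGroup_iff (Fin 3) ℝ).1 hA.1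
  have h2 : ∀ w : E3, w = (inner ℝ w (e 0) : ℝ) • e 0 + (inner ℝ w (e 1) : ℝ) • e 1
      + (inner ℝ w (e 2) : ℝ) • e 2 := fun w => by
    apply E3_ext <;> simp [e, inner_E3]
  have h3 : v = act A (act Aᵀ v) := by rw [← act_mul, h1, act_one]
  conv_lhs => rw [h3, h2 (act Aᵀ v)]
  simp only [inner_act]
  simp only [← actL_apply, map_add, map_smul]

section Closed

variable {a b : ℝ} [hab : Fact (a < b)] {Mf : ℝ → E3} {R : ℝ → Mat3}

/-- Since `R M = -e₃`, the third component of `R e₃` is opposite to that of `M`. -/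
theorem IsFrame.abs_inner_col_two (hR : IsFrame a b Mf R) {x : ℝ} (hx : x ∈ Icc a b) :
    |(inner ℝ (e 2) ((hR.col 2).rep x) : ℝ)| = |(inner ℝ (Mf x) (e 2) : ℝ)| := by
  obtain ⟨hO, hM⟩ := hR.2.2 x hx
  have h1 : (R x)ᵀ * R x = 1 := (Matrix.mem_orthogonalGroup_iff' (Fin 3) ℝ).1 hO.1
  have h2 : act (R x)ᵀ (e 2) = -Mf x := by
    have h3 := congrArg (act (R x)ᵀ) hM
    rw [← act_mul, h1, act_one, act_neg] at h3
    rw [h3, neg_neg]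
  rw [hR.rep_col 2 hx, inner_act, h2, inner_neg_left, abs_neg]

/-! ### The closed-loop system as an evolution equation in `H¹` -/

/-- The operators `N ↦ F(t) eᵢ ∧ N` on `H¹`. -/
def IsFrame.op (hR : IsFrame a b Mf R) (T : ℝ) (i : Fin 2) (t : ℝ) : H1 a b →L[ℝ] H1 a b :=
  H1.wedgeH1 (H1.col hR.cols i (sigma T t))

theorem IsFrame.continuous_op (hR : IsFrame a b Mf R) (T : ℝ) (i : Fin 2) :
    Continuous (hR.op T i) :=
  (H1.wedgeH1 (a := a) (b := b)).continuous.comp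
    ((H1.continuous_col hR.cols i).comp (continuous_sigma T))

theorem IsFrame.periodic_op (hR : IsFrame a b Mf R) {T : ℝ} (hT : 0 < T) (i : Fin 2) :
    Function.Periodic (hR.op T i) (2 * T) := fun t => by
  rw [IsFrame.op, IsFrame.op, periodic_sigma hT t]

theorem IsFrame.exists_norm_op_le (hR : IsFrame a b Mf R) {T : ℝ} (hT : 0 < T) :
    ∃ β : ℝ, ∀ i t, ‖hR.op T i t‖ ≤ β := by
  have h : ∀ i, ∃ β : ℝ, ∀ t, ‖hR.op T i t‖ ≤ β := fun i => by
    have hp : Function.Periodic (fun t => ‖hR.op T i t‖) (2 * T) :=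
      (hR.periodic_op hT i).comp _
    have hc : Continuous fun t => ‖hR.op T i t‖ :=
      (continuous_norm (E := H1 a b →L[ℝ] H1 a b)).comp (hR.continuous_op T i)
    obtain ⟨β, hβ⟩ := (hp.isBounded_of_continuous (by positivity) hc).exists_norm_le
    exact ⟨β, fun t => (le_abs_self _).trans (hβ _ (mem_range_self t))⟩
  choose β hβ using h
  exact ⟨max (β 0) (β 1), fun i t => by
    fin_cases i
    · exact (hβ 0 t).trans (le_max_left _ _)
    · exact (hβ 1 t).trans (le_max_right _ _)⟩

theorem IsFrame.feedback_op (hR : IsFrame a b Mf R) (T t : ℝ) (N : H1 a b) :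
    feedback (hR.op T) (H1.const a b (e 2)) t (N + H1.const a b (e 2))
      = ∑ i, u a b T R i t N • hR.op T i t N := by
  simp only [feedback, output, add_sub_cancel_right, u, hR.H_eq, neg_smul, Finset.sum_neg_distrib]
  rfl

theorem IsFrame.val_sum_op (hR : IsFrame a b Mf R) (T t : ℝ) (N : H1 a b) (c : Fin 2 → ℝ) :
    (∑ i, c i • hR.op T i t N).val =ᵐ[leb a b]
      fun ω => ∑ i : Fin 2, c i • wedge (act (F T R t ω) (e i.castSucc)) (N.val ω) := by
  filter_upwards [(∑ i, c i • hR.op T i t N).rep_ae, N.rep_ae, ae_leb_mem a b] with x h1 h2 hm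
  have hx := Ioo_subset_Icc_self hm
  rw [← h1, ← h2, Fin.sum_univ_two, Fin.sum_univ_two, H1.rep_add _ _ hx, H1.rep_smul _ _ hx,
    H1.rep_smul _ _ hx, hR.act_F T t 0 hx, hR.act_F T t 1 hx]
  simp only [IsFrame.op, H1.rep_wedgeH1 _ _ hx]

/-- In the variable `y = N + e₃`, the closed-loop system is `y' = feedback y`. -/
theorem IsFrame.isSolution_iff (hR : IsFrame a b Mf R) (T : ℝ) (N₀ : H1 a b) (N : ℝ → H1 a b) :
    IsSolution a b T R N₀ N ↔ N 0 = N₀ ∧ ∀ t, 0 ≤ t →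
      HasDerivWithinAt (fun t => N t + H1.const a b (e 2))
        (feedback (hR.op T) (H1.const a b (e 2)) t (N t + H1.const a b (e 2))) (Ici 0) t := by
  refine and_congr_right fun _ => ⟨?_, fun h => ?_⟩
  · rintro ⟨N', -, hN⟩ t ht
    obtain ⟨h1, h2⟩ := hN t ht
    have h3 : N' t = feedback (hR.op T) (H1.const a b (e 2)) t (N t + H1.const a b (e 2)) := by
      rw [hR.feedback_op]
      have h4 : (N' t).val =ᵐ[leb a b] fun ω => ∑ i : Fin 2, u a b T R i t (N t) •
          wedge (act (F T R t ω) (e i.castSucc)) ((N t).val ω) := h2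
      exact H1.ext_val (h4.trans (hR.val_sum_op T t (N t) _).symm)
    rw [← h3]
    exact h1.add_const _
  · have hd : ∀ t, 0 ≤ t → HasDerivWithinAt N
        (feedback (hR.op T) (H1.const a b (e 2)) t (N t + H1.const a b (e 2))) (Ici 0) t :=
      fun t ht => by simpa using (h t ht).sub_const (H1.const a b (e 2))
    refine ⟨fun t => feedback (hR.op T) (H1.const a b (e 2)) t (N t + H1.const a b (e 2)), ?_,
      fun t ht => ⟨hd t ht, ?_⟩⟩
    · have hc : ContinuousOn N (Ici 0) := fun t ht => (hd t ht).continuousWithinAt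
      unfold feedback output
      simp only [add_sub_cancel_right]
      refine (continuousOn_finsetSum _ fun i _ => ?_).neg
      have h2 : ContinuousOn (fun t => hR.op T i t (N t)) (Ici 0) :=
        (hR.continuous_op T i).continuousOn.clm_apply hc
      exact (ContinuousOn.inner (𝕜 := ℝ) (hc.add continuousOn_const) h2).smul h2
    · simp only [hR.feedback_op]
      exact hR.val_sum_op T t (N t) _

/-- The flow acts pointwise by rotations, so it preserves the sphere. -/
theorem IsFrame.norm_rep_eq_one (hR : IsFrame a b Mf R) {T : ℝ} {N₀ : H1 a b} {N : ℝ → H1 a b}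
    (hN : IsSolution a b T R N₀ N) (h0 : ∀ᵐ ω ∂(leb a b), ‖N₀.val ω‖ = 1) {t : ℝ} (ht : 0 ≤ t)
    {x : ℝ} (hx : x ∈ Icc a b) : ‖(N t).rep x‖ = 1 := by
  obtain ⟨hN0, hN⟩ := (hR.isSolution_iff T N₀ N).1 hN
  have hinit : ‖N₀.rep x‖ = 1 := by
    refine eqOn_Icc_of_ae_eq_leb (f := fun x => ‖N₀.rep x‖) (g := fun _ => 1) hab.out ?_
      N₀.rep_ac.continuousOn_Icc.norm continuousOn_const x hx
    filter_upwards [h0, N₀.rep_ae] with y h1 h2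
    rw [h2, h1]
  have hd : ∀ t, 0 ≤ t → HasDerivWithinAt (fun t => ‖(N t).rep x‖ ^ 2) 0 (Ici 0) t := by
    intro t ht
    have h1 := (hN t ht).sub_const (H1.const a b (e 2))
    simp only [add_sub_cancel_right] at h1
    have h2 := ((H1.ev x hx).hasFDerivAt.comp_hasDerivWithinAt t h1).norm_sq
    refine h2.congr_deriv ?_
    rw [hR.feedback_op, Fin.sum_univ_two]
    change 2 * inner ℝ ((N t).rep x) (H1.rep _ x) = 0
    rw [H1.rep_add _ _ hx, H1.rep_smul _ _ hx, H1.rep_smul _ _ hx, inner_add_right,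
      inner_smul_right, inner_smul_right]
    simp only [IsFrame.op, H1.rep_wedgeH1 _ _ hx, inner_self_wedge]
    ring
  have hconst : ‖(N t).rep x‖ ^ 2 = ‖(N 0).rep x‖ ^ 2 := by
    refine constant_of_has_deriv_right_zero
      (f := fun t => ‖(N t).rep x‖ ^ 2) (a := 0) (b := t)
      (fun s hs => (hd s hs.1).continuousWithinAt.mono Icc_subset_Ici_self)
      (fun s hs => (hd s hs.1).mono (Ici_subset_Ici.2 hs.1)) t ⟨ht, le_rfl⟩
  rw [hN0, hinit, one_pow] at hconst
  exact (pow_eq_one_iff_of_nonneg (norm_nonneg _) two_ne_zero).1 hconst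

/-- If the output vanishes on the limit profile throughout a time interval on which `σ(t) = t`, then
the functional vanishes on the products of the first two columns with monomials. -/
theorem IsFrame.inner_wedge_pow_eq_zero (hR : IsFrame a b Mf R) {T : ℝ} (hT : 0 < T)
    (N v : H1 a b) (h : ∀ i, ∀ s ∈ Icc 0 T, inner ℝ (N + v) (hR.op T i s N) = (0 : ℝ)) (k : ℕ) :
    inner ℝ (N + v) (H1.wedgeH1 ((H1.mulX ^ k) (hR.col 0)) N) = (0 : ℝ) ∧
      inner ℝ (N + v) (H1.wedgeH1 ((H1.mulX ^ k) (hR.col 1)) N) = (0 : ℝ) := by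
  have key := eq_zero_of_rotPair (V := H1 a b) H1.mulX hR.cols
    ((innerSL ℝ (N + v)).comp ((H1.wedgeH1 (a := a) (b := b)).flip N)) hT
    (fun s hs => by
      have h0 := h 0 s hs
      have h1 := h 1 s hs
      rw [IsFrame.op, sigma_eq_self hT hs] at h0 h1
      exact ⟨h0, h1⟩) k
  exact key

end Closed

/-! ### Convergence -/

section Convergence

variable {a b : ℝ} [hab : Fact (a < b)] {Mf : ℝ → E3} {R : ℝ → Mat3}

theorem IsFrame.exists_isSolution (hR : IsFrame a b Mf R) {T : ℝ} (hT : 0 < T) (N₀ : H1 a b) :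
    ∃ N : ℝ → H1 a b, IsSolution a b T R N₀ N ∧
      ∀ N₂ : ℝ → H1 a b, IsSolution a b T R N₀ N₂ → ∀ t : ℝ, 0 ≤ t → N₂ t = N t := by
  obtain ⟨β, hβ⟩ := hR.exists_norm_op_le hT
  have hlip := lipschitzOnWith_feedback hβ (H1.const a b (e 2))
  obtain ⟨y, hy0, hy⟩ := exists_global_of_dissipative
    (continuous_feedback (hR.continuous_op T) (H1.const a b (e 2))) hlip
    (feedback_zero (hR.op T) _) (inner_feedback_nonpos (hR.op T) _) (N₀ + H1.const a b (e 2))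
  refine ⟨fun t => y t - H1.const a b (e 2), (hR.isSolution_iff T N₀ _).2 ⟨?_, ?_⟩,
    fun N₂ h₂ t ht => ?_⟩
  · rw [hy0, add_sub_cancel_right]
  · simpa only [sub_add_cancel] using hy
  · obtain ⟨h0, hN₂⟩ := (hR.isSolution_iff T N₀ N₂).1 h₂
    have := unique_of_dissipative hlip (inner_feedback_nonpos (hR.op T) _) hN₂ hy
      (by rw [h0, hy0]) t ht
    exact eq_sub_of_add_eq this

theorem IsFrame.norm_add_e3_le (hR : IsFrame a b Mf R) {T : ℝ} {N₀ : H1 a b} {N : ℝ → H1 a b}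
    (hN : IsSolution a b T R N₀ N) {t : ℝ} (ht : 0 ≤ t) :
    ‖N t + H1.const a b (e 2)‖ ≤ ‖N₀ + H1.const a b (e 2)‖ := by
  obtain ⟨hN0, hy⟩ := (hR.isSolution_iff T N₀ N).1 hN
  have := norm_antitoneOn hy (fun t _ => inner_feedback_nonpos (hR.op T) _ t _)
    (mem_Ici.2 le_rfl) (mem_Ici.2 ht) ht
  simpa only [hN0] using this

theorem IsFrame.norm_le (hR : IsFrame a b Mf R) {T : ℝ} {N₀ : H1 a b} {N : ℝ → H1 a b}
    (hN : IsSolution a b T R N₀ N) {t : ℝ} (ht : 0 ≤ t) :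
    ‖N t‖ ≤ ‖N₀ + H1.const a b (e 2)‖ + ‖H1.const a b (e 2)‖ := by
  have h1 := norm_sub_le (N t + H1.const a b (e 2)) (H1.const a b (e 2))
  rw [add_sub_cancel_right] at h1
  linarith [hR.norm_add_e3_le hN ht]

/-- A weak limit along an ultrafilter of a solution that starts close to `-e₃` is `-e₃`. -/
theorem IsFrame.eq_neg_e3_of_weak_limit (hR : IsFrame a b Mf R) {T : ℝ} (hT : 0 < T) {c K : ℝ}
    (hc : 0 < c) (hc1 : c ≤ 1) (hMc : ∀ x ∈ Icc a b, c ≤ |(inner ℝ (Mf x) (e 2) : ℝ)|)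
    (hK : 0 < K) (hKN : ∀ (N : H1 a b), ∀ x ∈ Icc a b, ‖N.rep x‖ ≤ K * ‖N‖)
    {N₀ : H1 a b} {N : ℝ → H1 a b} (hN : IsSolution a b T R N₀ N)
    (h0 : ∀ᵐ ω ∂(leb a b), ‖N₀.val ω‖ = 1) (hN₀ : ‖N₀ + H1.const a b (e 2)‖ ≤ c / (2 * K))
    {U : Ultrafilter ℝ} (hU : (U : Filter ℝ) ≤ atTop) {N' : H1 a b}
    (hN' : ∀ φ : H1 a b →L[ℝ] ℝ, Tendsto (fun t => φ (N t)) U (𝓝 (φ N'))) :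
    N' = -H1.const a b (e 2) := by
  obtain ⟨hN0, hy⟩ := (hR.isSolution_iff T N₀ N).1 hN
  obtain ⟨β, hβ⟩ := hR.exists_norm_op_le hT
  have hpos : ∀ᶠ t in (U : Filter ℝ), 0 ≤ t := hU (eventually_ge_atTop 0)
  have hbd : ∀ t, 0 ≤ t → ‖N t + H1.const a b (e 2)‖ ≤ c / (2 * K) := fun t ht =>
    (hR.norm_add_e3_le hN ht).trans hN₀
  have hM : ∀ᶠ t in (U : Filter ℝ), ‖N t‖ ≤ _ := hpos.mono fun t ht => hR.norm_le hN ht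
  -- The outputs vanish on the limit.
  have hout : ∀ i, ∀ s ∈ Icc 0 T,
      inner ℝ (N' + H1.const a b (e 2)) (hR.op T i s N') = (0 : ℝ) := fun i s _ => by
    have h1 := (tendsto_output (by positivity : 0 < 2 * T) (hR.continuous_op T) (hR.periodic_op hT)
      hβ (H1.const a b (e 2)) hy i s).mono_left hU
    simp only [output, add_sub_cancel_right] at h1
    exact tendsto_nhds_unique (H1.tendsto_inner_wedgeH1 hN' hM _ _) h1
  have hmom := hR.inner_wedge_pow_eq_zero hT N' (H1.const a b (e 2)) hout
  -- The pointwise constraints pass to the limit.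
  have hsph : ∀ x ∈ Icc a b, ‖N'.rep x‖ = 1 := fun x hx => by
    refine tendsto_nhds_unique (H1.tendsto_rep_of_weak hN' hx).norm
      (tendsto_const_nhds.congr' ?_)
    filter_upwards [hpos] with t ht using (hR.norm_rep_eq_one hN h0 ht hx).symm
  have hclose : ∀ x ∈ Icc a b, ‖N'.rep x + e 2‖ ≤ c / 2 := fun x hx => by
    refine le_of_tendsto ((H1.tendsto_rep_of_weak hN' hx).add_const (e 2)).norm ?_
    filter_upwards [hpos] with t ht
    have h1 := hKN (N t + H1.const a b (e 2)) x hx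
    rw [H1.rep_add _ _ hx, H1.rep_const _ hx] at h1
    refine h1.trans ((mul_le_mul_of_nonneg_left (hbd t ht) hK.le).trans_eq ?_)
    field_simp
  refine H1.ext_rep fun x hx => ?_
  rw [H1.rep_neg _ hx, H1.rep_const _ hx]
  refine H1.eq_neg_e3_of_rigid N' (hR.col 0) (hR.col 1) (hR.col 2) (half_pos hc)
    (fun x hx v => ?_) hsph (fun x hx => ?_) (fun x hx => ?_) (fun k => (hmom k).1)
    (fun k => (hmom k).2) x hx
  · simp only [hR.rep_col _ hx]
    exact eq_sum_inner_col (hR.2.2 x hx).1 v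
  -- The third component of `N'` is within `c / 2 ≤ 1 / 2` of `-1`.
  · have h1 := (PiLp.norm_apply_le (N'.rep x + e 2) 2).trans (hclose x hx)
    have h2 := (abs_le.1 h1).2
    simp only [PiLp.add_apply, e, EuclideanSpace.single, PiLp.single_apply, if_true] at h2
    linarith
  -- The component of `N'` along `R e₃` is within `c / 2` of that of `-e₃`, which is at least `c`.
  · have hunit : ‖(hR.col 2).rep x‖ = 1 := by
      have hO := (Matrix.mem_orthogonalGroup_iff' (Fin 3) ℝ).1 (hR.2.2 x hx).1.1
      have h1 : (inner ℝ ((hR.col 2).rep x) ((hR.col 2).rep x) : ℝ) = 1 := by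
        rw [hR.rep_col 2 hx, inner_act, ← act_mul, hO, act_one]
        simp [e]
      rw [real_inner_self_eq_norm_sq] at h1
      exact (pow_eq_one_iff_of_nonneg (norm_nonneg _) two_ne_zero).1 h1
    have h1 := abs_real_inner_le_norm (N'.rep x + e 2) ((hR.col 2).rep x)
    rw [hunit, mul_one, inner_add_left] at h1
    have h2 := hR.abs_inner_col_two hx
    have h3 := hMc x hx
    have h4 := hclose x hx
    rw [← h2] at h3
    have h5 := abs_sub_abs_le_abs_sub (inner ℝ (e 2) ((hR.col 2).rep x) : ℝ)
      (-inner ℝ (N'.rep x) ((hR.col 2).rep x))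
    rw [abs_neg, sub_neg_eq_add, add_comm (inner ℝ (e 2) _ : ℝ)] at h5
    linarith

end Convergence

end BlochEnsemble

end

open BlochEnsemble in
theorem theorem1 (a b : ℝ) (hab : a < b) (T : ℝ) (hT : 0 < T) (C : ℝ)
    (Mf : ℝ → E3) (hMc : ContinuousOn Mf (Icc a b)) (hM : MemH1 a b Mf)
    (hMs : ∀ ω ∈ Icc a b, ‖Mf ω‖ = 1)
    (hMe : ∀ ω ∈ Icc a b, inner ℝ (Mf ω) (e 2) ≠ 0) :
    ∃ δ₁ : ℝ, 0 < δ₁ ∧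
      ∀ R : ℝ → Mat3, IsFrame a b Mf R → normH1 a b R ≤ C * normH1 a b Mf →
      ∀ N₀ : H1 a b, (∀ᵐ ω ∂(leb a b), ‖N₀.val ω‖ = 1) → ‖N₀ + H1.const a b (e 2)‖ ≤ δ₁ →
      ∃ N : ℝ → H1 a b, IsSolution a b T R N₀ N ∧
        (∀ N₂ : ℝ → H1 a b, IsSolution a b T R N₀ N₂ → ∀ t : ℝ, 0 ≤ t → N₂ t = N t) ∧
        Tendsto (fun t => toWeakSpace ℝ (H1 a b) (N t)) atTop
          (𝓝 (toWeakSpace ℝ (H1 a b) (-H1.const a b (e 2)))) := by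
  have : Fact (a < b) := ⟨hab⟩
  obtain ⟨x₀, hx₀, hmin⟩ := isCompact_Icc.exists_isMinOn (nonempty_Icc.2 hab.le)
    ((hMc.inner (𝕜 := ℝ) continuousOn_const).abs : ContinuousOn (fun x => |inner ℝ (Mf x) (e 2)|) _)
  obtain ⟨K, hK, hKN⟩ := H1.exists_norm_rep_le a b
  set c : ℝ := |inner ℝ (Mf x₀) (e 2)| with hcdef
  have hc : 0 < c := abs_pos.2 (hMe x₀ hx₀)
  have hc1 : c ≤ 1 := by
    refine (abs_real_inner_le_norm _ _).trans ?_
    rw [hMs x₀ hx₀, one_mul]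
    simp [e]
  -- By the embedding, solutions stay pointwise within `c / 2` of `-e₃`, where `c` bounds from below
  -- the component of `e₃` along `R e₃`.
  refine ⟨c / (2 * K), by positivity, fun R hR _ N₀ h0 hN₀ => ?_⟩
  obtain ⟨N, hN, huniq⟩ := hR.exists_isSolution hT N₀
  refine ⟨N, hN, huniq, tendsto_toWeakSpace fun φ => ?_⟩
  rw [tendsto_iff_ultrafilter]
  intro U hU
  have hpos : ∀ᶠ t in (U : Filter ℝ), 0 ≤ t := hU (eventually_ge_atTop 0)
  obtain ⟨N', hN'⟩ := exists_weak_limit U (hpos.mono fun t ht => hR.norm_le hN ht)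
  have := hR.eq_neg_e3_of_weak_limit hT hc hc1 (fun x hx => hmin hx) hK hKN hN h0 hN₀ hU hN'
  rw [← this]
  exact hN' φ
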